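/- **Definitions.** A *knotoid diagram* $K$ is a smooth immersion of an oriented interval into the oriented sphere $S^2$, injective except for finitely many transverse double points (crossings) in its interior, with over/under information at each crossing; it starts at its tail $v_0$ and ends at its head $v_1$. A *knotoid* $k$ is an equivalence class of knotoid diagrams under planar isotopy and Reidemeister moves I, II, III performed away from the endpoints. A *shortcut* $a$ for $K$ is a smoothly embedded path from $v_0$ to $v_1$ in $S^2$ that avoids the crossings of $K$ and meets $K$ transversely in finitely many points away from the endpoints. Such an intersection point is *positive* if the tangent of $a$ followed by the tangent of $K$ is a positive basis of the tangent plane, and *negative* otherwise. Let $h_+(K,a)$ and $h_-(K,a)$ be the numbers of positive and negative intersection points (the endpoints are not counted), and let $h_\pm(k)$ be the minimum of $h_\pm(K,a)$ over all diagrams $K$ of $k$ and all shortcuts $a$ for $K$. The *sign* of a crossing is $+1$ if the tangent of the over-strand followed by the tangent of the under-strand is a positive basis, and $-1$ otherwise. Resolving a crossing $c$ of $K$ respecting orientation splits off a loop $L$, the part of $K$ from $c$ back to $c$; the *index* of $c$ is the winding number of $L$ in the twice-punctured sphere $S^2\setminus\{v_0,v_1\}$, counted counterclockwise around $v_0$ (equivalently,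 the signed number of intersections of $L$ with any shortcut). For $n\neq 0$, the *$n$-writhe* $J_n(K)$ is half the sum of the signs of the crossings of index $n$. It depends only on the knotoid $k$ represented by $K$, so write $J_n(k)=J_n(K)$. The *index polynomial* of $k$ is the Laurent polynomial $$F_k(t)=\sum_{n\ne 0}J_n(k)\,(t^n-1).$$ For a nonzero Laurent polynomial $p$ put $\deg^+(p)=\max\{\operatorname{maxdeg}(p),0\}$ and $\deg^-(p)=\max\{-\operatorname{mindeg}(p),0\}$, and put $\deg^\pm(0)=0$. **Theorem.** For every knotoid $k$, $$h_+(k)\ge\deg^+(F_k)\qquad\text{and}\qquad h_-(k)\ge\deg^-(F_k).$$ -/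

import Mathlib

open Set
open scoped ContDiff LaurentPolynomial

noncomputable section

namespace Knotoids

/-- Euclidean three-space. The sphere `S²` is the unit sphere in it. -/
abbrev E3 : Type := EuclideanSpace ℝ (Fin 3)

/-- The unit sphere `S²`. -/
abbrev S2 : Set E3 := Metric.sphere (0 : E3) 1

/-- The determinant of three vectors of three-space. The sphere is oriented by its outward normal:
an ordered pair `(v, w)` of tangent vectors at `p ∈ S²` is a positive basis of the tangent plane
iff `0 < det3 p v w`, and it is a basis iff `det3 p v w ≠ 0`. -/
def det3 (u v w : E3) : ℝ :=
  Matrix.det !![u 0, u 1, u 2; v 0, v 1, v 2; w 0, w 1, w 2]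

/-- `γ` takes the parameters `x ≠ y` of the unit interval to the same point. -/
def IsDouble (γ : ℝ → E3) (x y : ℝ) : Prop :=
  x ∈ Icc (0 : ℝ) 1 ∧ y ∈ Icc (0 : ℝ) 1 ∧ x ≠ y ∧ γ x = γ y

/-- A knotoid diagram: a smooth immersion of `[0,1]` in `S²`, injective except for finitely many
transverse double points, none of them at an end of the interval, with over/under information at
each double point. The tail is the image of `0` and the head is the image of `1`.
A smooth map on `[0,1]` is the restriction of a smooth map on `ℝ`; only its values on `[0,1]`,
and only the values of `isOver` at pairs of parameters of a double point, carry information. -/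
structure KnotoidDiagram where
  /-- the immersed path -/
  toFun : ℝ → E3
  /-- `isOver x y`: at the double point with parameters `x, y`, the strand through the parameter `x`
  passes over the strand through the parameter `y` -/
  isOver : ℝ → ℝ → Prop
  smooth : ContDiff ℝ ∞ toFun
  mem_sphere : ∀ x ∈ Icc (0 : ℝ) 1, toFun x ∈ S2
  immersion : ∀ x ∈ Icc (0 : ℝ) 1, deriv toFun x ≠ 0
  finite_double : {c : ℝ × ℝ | IsDouble toFun c.1 c.2}.Finite
  double_interior : ∀ x y, IsDouble toFun x y → x ∈ Ioo (0 : ℝ) 1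
  no_triple : ∀ x y z, IsDouble toFun x y → IsDouble toFun x z → y = z
  transverse : ∀ x y, IsDouble toFun x y → det3 (toFun x) (deriv toFun x) (deriv toFun y) ≠ 0
  isOver_iff : ∀ x y, IsDouble toFun x y → (isOver x y ↔ ¬ isOver y x)

namespace KnotoidDiagram

variable (K : KnotoidDiagram)

/-- The tail `v₀`. -/
def tail : E3 := K.toFun 0

/-- The head `v₁`. -/
def head : E3 := K.toFun 1

/-- The crossings, each given by its two parameters in increasing order. -/
def crossings : Set (ℝ × ℝ) := {c | IsDouble K.toFun c.1 c.2 ∧ c.1 < c.2}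

open Classical in
/-- The sign of a crossing: `+1` if (tangent of the over-strand, tangent of the under-strand) is a
positive basis, and `-1` otherwise. -/
def crossingSign (c : ℝ × ℝ) : ℤ :=
  if K.isOver c.1 c.2 then
    (if 0 < det3 (K.toFun c.1) (deriv K.toFun c.1) (deriv K.toFun c.2) then 1 else -1)
  else
    (if 0 < det3 (K.toFun c.1) (deriv K.toFun c.2) (deriv K.toFun c.1) then 1 else -1)

end KnotoidDiagram

/-! ### Planar isotopy and Reidemeister moves -/

/-- A smooth ambient isotopy of `S²`: a smooth family of diffeomorphisms of `S²` that starts at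
the identity. Smooth maps on `S²` are restrictions of smooth maps on three-space. -/
structure SphereIsotopy where
  /-- the family of diffeomorphisms -/
  toFun : ℝ → E3 → E3
  /-- the family of inverse diffeomorphisms -/
  inv : ℝ → E3 → E3
  smooth : ContDiff ℝ ∞ (Function.uncurry toFun)
  inv_smooth : ContDiff ℝ ∞ (Function.uncurry inv)
  mapsTo : ∀ τ, MapsTo (toFun τ) S2 S2
  inv_mapsTo : ∀ τ, MapsTo (inv τ) S2 S2
  left_inv : ∀ τ, ∀ p ∈ S2, inv τ (toFun τ p) = p
  right_inv : ∀ τ, ∀ p ∈ S2, toFun τ (inv τ p) = p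
  map_zero : ∀ p ∈ S2, toFun 0 p = p

/-- A closed disk embedded in `S²`. -/
structure SphereDisk where
  /-- the embedding of the closed unit disk -/
  toFun : ℂ → E3
  continuousOn : ContinuousOn toFun (Metric.closedBall 0 1)
  injOn : InjOn toFun (Metric.closedBall 0 1)
  mapsTo : MapsTo toFun (Metric.closedBall 0 1) S2

/-- The points of the closed disk. -/
def SphereDisk.carrier (D : SphereDisk) : Set E3 := D.toFun '' Metric.closedBall 0 1

/-- The points of the disk that are not on its boundary circle. -/
def SphereDisk.interior (D : SphereDisk) : Set E3 := D.toFun '' Metric.ball 0 1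

/-- The diagram `K` meets the disk `D` exactly in the `m` proper arcs parametrized by the disjoint
intervals `[s i, t i]`, and has no crossing on the boundary circle of `D`. The ends of `K` are not
in `D`. The intervals may come in any order along `K`. -/
structure MeetsDiskIn (K : KnotoidDiagram) (D : SphereDisk) {m : ℕ} (s t : Fin m → ℝ) : Prop where
  bounds : ∀ i, 0 < s i ∧ s i < t i ∧ t i < 1
  disjoint : ∀ i j, i ≠ j → Disjoint (Icc (s i) (t i)) (Icc (s j) (t j))
  mem_carrier : ∀ x ∈ Icc (0 : ℝ) 1, K.toFun x ∈ D.carrier ↔ ∃ i, x ∈ Icc (s i) (t i)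
  mem_interior : ∀ x ∈ Icc (0 : ℝ) 1, K.toFun x ∈ D.interior ↔ ∃ i, x ∈ Ioo (s i) (t i)
  no_boundary_crossing : ∀ x y, IsDouble K.toFun x y →
    K.toFun x ∈ D.carrier → K.toFun x ∈ D.interior

/-- The diagrams `K` and `K'` both meet the disk `D` in arcs parametrized by the intervals
`[s i, t i]`, and they are the same outside `D`. -/
structure DifferInDisk (K K' : KnotoidDiagram) (D : SphereDisk) {m : ℕ} (s t : Fin m → ℝ) :
    Prop where
  left : MeetsDiskIn K D s t
  right : MeetsDiskIn K' D s t
  eq_off : ∀ x ∈ Icc (0 : ℝ) 1, (∀ i, x ∉ Ioo (s i) (t i)) → K'.toFun x = K.toFun x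
  over_off : ∀ x y, (∀ i, x ∉ Ioo (s i) (t i)) → (∀ i, y ∉ Ioo (s i) (t i)) →
    IsDouble K.toFun x y → (K'.isOver x y ↔ K.isOver x y)

/-- The crossings of the arc `i` with itself. -/
def selfCrossings (K : KnotoidDiagram) {m : ℕ} (s t : Fin m → ℝ) (i : Fin m) : Set (ℝ × ℝ) :=
  {c | c ∈ K.crossings ∧ c.1 ∈ Ioo (s i) (t i) ∧ c.2 ∈ Ioo (s i) (t i)}

/-- The crossings of the arc `i` with the arc `j`, for `i ≠ j`; the parameter on the arc `i` comes
first. -/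
def mutualCrossings (K : KnotoidDiagram) {m : ℕ} (s t : Fin m → ℝ) (i j : Fin m) : Set (ℝ × ℝ) :=
  {c | IsDouble K.toFun c.1 c.2 ∧ c.1 ∈ Ioo (s i) (t i) ∧ c.2 ∈ Ioo (s j) (t j)}

/-- The elementary changes of a knotoid diagram. Inverses are supplied by the equivalence relation
below. -/
inductive Move : KnotoidDiagram → KnotoidDiagram → Prop
  /-- Orientation-preserving change of the parameter. -/
  | reparam (K K' : KnotoidDiagram) (ρ : ℝ → ℝ) (smooth : ContDiff ℝ ∞ ρ)
      (deriv_pos : ∀ x ∈ Icc (0 : ℝ) 1, 0 < deriv ρ x) (zero : ρ 0 = 0) (one : ρ 1 = 1)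
      (eq_comp : ∀ x ∈ Icc (0 : ℝ) 1, K'.toFun x = K.toFun (ρ x))
      (over_comp : ∀ x y, IsDouble K'.toFun x y → (K'.isOver x y ↔ K.isOver (ρ x) (ρ y))) : Move K K'
  /-- Planar isotopy. -/
  | isotopy (K K' : KnotoidDiagram) (Φ : SphereIsotopy)
      (eq_comp : ∀ x ∈ Icc (0 : ℝ) 1, K'.toFun x = Φ.toFun 1 (K.toFun x))
      (over_eq : ∀ x y, IsDouble K'.toFun x y → (K'.isOver x y ↔ K.isOver x y)) : Move K K'
  /-- Reidemeister I: in a disk, an embedded arc is replaced by an arc with one self-crossing. -/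
  | reidemeister_one (K K' : KnotoidDiagram) (D : SphereDisk) (s t : Fin 1 → ℝ)
      (off : DifferInDisk K K' D s t)
      (before : selfCrossings K s t 0 = ∅)
      (after : (selfCrossings K' s t 0).ncard = 1) : Move K K'
  /-- Reidemeister II: in a disk, two disjoint embedded arcs are replaced by two embedded arcs that
  cross each other twice, the first one passing over the second at both crossings. -/
  | reidemeister_two (K K' : KnotoidDiagram) (D : SphereDisk) (s t : Fin 2 → ℝ)
      (off : DifferInDisk K K' D s t)
      (embedded : ∀ i, selfCrossings K s t i = ∅)
      (embedded' : ∀ i, selfCrossings K' s t i = ∅)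
      (before : mutualCrossings K s t 0 1 = ∅)
      (after : (mutualCrossings K' s t 0 1).ncard = 2)
      (layers : ∀ c ∈ mutualCrossings K' s t 0 1, K'.isOver c.1 c.2) : Move K K'
  /-- Reidemeister III: in a disk, three embedded arcs (top, middle, bottom) that cross each other
  once each are replaced by three arcs of the same kind, with the same ends and layers. Two such
  triples are either isotopic in the disk, or one arc has been moved across the crossing of the
  other two. -/
  | reidemeister_three (K K' : KnotoidDiagram) (D : SphereDisk) (s t : Fin 3 → ℝ)
      (off : DifferInDisk K K' D s t)
      (embedded : ∀ i, selfCrossings K s t i = ∅)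
      (embedded' : ∀ i, selfCrossings K' s t i = ∅)
      (before : ∀ i j, i < j → (mutualCrossings K s t i j).ncard = 1)
      (after : ∀ i j, i < j → (mutualCrossings K' s t i j).ncard = 1)
      (layers : ∀ i j, i < j → ∀ c ∈ mutualCrossings K s t i j, K.isOver c.1 c.2)
      (layers' : ∀ i j, i < j → ∀ c ∈ mutualCrossings K' s t i j, K'.isOver c.1 c.2) : Move K K'

/-- The equivalence relation on knotoid diagrams generated by planar isotopy and the Reidemeister
moves away from the endpoints. -/
def diagramSetoid : Setoid KnotoidDiagram := Relation.EqvGen.setoid Move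

/-- A knotoid is an equivalence class of knotoid diagrams. -/
def Knotoid : Type := Quotient diagramSetoid

/-- The diagram `K` represents the knotoid `k`. -/
def KnotoidDiagram.Represents (K : KnotoidDiagram) (k : Knotoid) : Prop :=
  (Quotient.mk diagramSetoid K : Knotoid) = k

/-! ### Shortcuts and signed heights -/

/-- A shortcut for `K`: a smoothly embedded path in `S²` from the tail to the head of `K` that does
not pass through a crossing of `K`, and meets `K` transversely, in finitely many points, away from
the endpoints. As for diagrams, only the values on `[0,1]` matter. -/
structure Shortcut (K : KnotoidDiagram) where
  /-- the embedded path -/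
  toFun : ℝ → E3
  smooth : ContDiff ℝ ∞ toFun
  mem_sphere : ∀ u ∈ Icc (0 : ℝ) 1, toFun u ∈ S2
  immersion : ∀ u ∈ Icc (0 : ℝ) 1, deriv toFun u ≠ 0
  injOn : InjOn toFun (Icc (0 : ℝ) 1)
  map_zero : toFun 0 = K.tail
  map_one : toFun 1 = K.head
  avoids_crossings : ∀ x y, IsDouble K.toFun x y → ∀ u ∈ Icc (0 : ℝ) 1, toFun u ≠ K.toFun x
  finite_inter : {c : ℝ × ℝ | c.1 ∈ Ioo (0 : ℝ) 1 ∧ c.2 ∈ Ioo (0 : ℝ) 1 ∧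
    K.toFun c.1 = toFun c.2}.Finite
  transverse : ∀ x ∈ Ioo (0 : ℝ) 1, ∀ u ∈ Ioo (0 : ℝ) 1, K.toFun x = toFun u →
    det3 (K.toFun x) (deriv toFun u) (deriv K.toFun x) ≠ 0

namespace Shortcut

variable {K : KnotoidDiagram} (a : Shortcut K)

/-- The intersections of the diagram with the shortcut, the endpoints excluded: pairs of a parameter
on the diagram and a parameter on the shortcut. -/
def intersections : Set (ℝ × ℝ) :=
  {c | c.1 ∈ Ioo (0 : ℝ) 1 ∧ c.2 ∈ Ioo (0 : ℝ) 1 ∧ K.toFun c.1 = a.toFun c.2}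

/-- The number of positive intersections: those where (tangent of the shortcut, tangent of the
diagram) is a positive basis, that is, the diagram crosses the shortcut from right to left. -/
def posHeight : ℕ :=
  {c ∈ a.intersections | 0 < det3 (K.toFun c.1) (deriv a.toFun c.2) (deriv K.toFun c.1)}.ncard

/-- The number of negative intersections. -/
def negHeight : ℕ :=
  {c ∈ a.intersections | det3 (K.toFun c.1) (deriv a.toFun c.2) (deriv K.toFun c.1) < 0}.ncard

end Shortcut

/-- The positive height `h₊(k)`: the minimum of the positive heights of all shortcut diagrams
representing `k`. -/
def Knotoid.posHeight (k : Knotoid) : ℕ∞ :=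
  ⨅ (K : KnotoidDiagram) (_ : K.Represents k) (a : Shortcut K), (a.posHeight : ℕ∞)

/-- The negative height `h₋(k)`. -/
def Knotoid.negHeight (k : Knotoid) : ℕ∞ :=
  ⨅ (K : KnotoidDiagram) (_ : K.Represents k) (a : Shortcut K), (a.negHeight : ℕ∞)

/-! ### Index, writhes and the index polynomial -/

/-- The loop `γ` on `[x, y]` in `S² ∖ {p, q}` has winding number `n` around the twice-punctured
sphere, counted counterclockwise around `p` as seen from outside the sphere.

The line through `p` and `q` meets `S²` in `p` and `q` only, and `S² ∖ {p, q}` is a deformation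
retract of the complement of this line; `n` is the number of right-handed turns around the line,
directed from `q` to `p`, read off from a continuous angular coordinate `θ` of cylindrical
coordinates `r, θ, ζ` around the line. -/
def HasWindingNumber (γ : ℝ → E3) (x y : ℝ) (p q : E3) (n : ℤ) : Prop :=
  ∃ u w : E3, 0 < det3 u w (p - q) ∧ ∃ r θ ζ : ℝ → ℝ, ContinuousOn θ (Icc x y) ∧
    (∀ z ∈ Icc x y, 0 < r z ∧
      γ z = p + r z • (Real.cos (θ z) • u + Real.sin (θ z) • w) + ζ z • (p - q)) ∧
    θ y - θ x = 2 * Real.pi * n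

namespace KnotoidDiagram

variable (K : KnotoidDiagram)

/-- The crossing `c` has intersection index `n`: the loop obtained by the oriented resolution of `c`,
which is the part of `K` between the two parameters of `c`, has winding number `n`. -/
def HasIndex (c : ℝ × ℝ) (n : ℤ) : Prop :=
  HasWindingNumber K.toFun c.1 c.2 K.tail K.head n

/-- The `n`-writhe: half the sum of the signs of the crossings of index `n`. -/
def writhe (n : ℤ) : ℚ :=
  (1 / 2) * ∑ᶠ c ∈ {c | c ∈ K.crossings ∧ K.HasIndex c n}, (K.crossingSign c : ℚ)

/-- The index polynomial `∑_{n ≠ 0} Jₙ (tⁿ - 1)`. -/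
def indexPolynomial : ℚ[T;T⁻¹] :=
  ∑ᶠ (n : ℤ) (_ : n ≠ 0), LaurentPolynomial.C (K.writhe n) * (LaurentPolynomial.T n - 1)

end KnotoidDiagram

/-- `deg⁺ p`: the larger of `0` and the largest exponent of `p`, and `0` for `p = 0`. -/
def degPos (p : ℚ[T;T⁻¹]) : ℕ := p.coeff.support.sup fun n : ℤ => n.toNat

/-- `deg⁻ p`: the larger of `0` and minus the smallest exponent of `p`, and `0` for `p = 0`. -/
def degNeg (p : ℚ[T;T⁻¹]) : ℕ := p.coeff.support.sup fun n : ℤ => (-n).toNat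

end Knotoids

end

/-! Two facts give the theorem. For `n ≠ 0` the writhe `Jₙ` is the same for all diagrams of a
knotoid, and for a diagram with a shortcut `a` every crossing has index between `-h₋(K,a)` and
`h₊(K,a)`. The polynomial, computed from whichever diagram carries the shortcut, then has all its
exponents in that interval.

The bound (`Shortcut.index_mem`) holds because the index is a signed intersection number of the loop
with `a`, counting only part of the intersections of `K` with `a`. To prove this, project
stereographically by `σ` from a point off both curves. On the rectangle of parameters of loop and
shortcut, the zeros of `σ(K s) - σ(a t)` are the intersections. Their signed number is the number of
turns along the boundary of the rectangle (`boundaryVar_eq_sum`). Two sides cancel because the loop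
closes; the other two give the winding around the tail minus that around the head. This difference
is the winding number around the axis, since up to a positive factor the projection along the axis
is `(z - z_p) * conj (z - z_q)` (`IsFrame.exists_axis`).

Invariance under reparametrization is a substitution. Under isotopy, signs and winding numbers are
locally constant in time. All three Reidemeister moves are cases of `DifferInDisk.writhe_eq`. The
disk misses both endpoints, so it carries a single-valued angle, and the angle along the arc `i` is
that function plus a constant `c i`. A self-crossing of an arc therefore has index zero, and all
crossings of the arcs `i` and `j` share an index read off from the two constants, the same before
and after the move. Since the arcs lie in layers, only the signed number of crossings of each pair
of arcs matters. It is again a boundary variation on a rectangle, whose sides follow one arc as seen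
from an end of the other on the boundary of the disk. A disk without a boundary point is simply
connected, so only the ends of the arcs count (`DifferInDisk.sum_pairSign_eq`). -/

noncomputable section

namespace Knotoids

open Filter Topology

/-! ### Continuous logarithms and their variation -/

/-- `ℓ` is a continuous logarithm of `g` on `S`. -/
structure IsLog {E : Type*} [TopologicalSpace E] (ℓ g : E → ℂ) (S : Set E) : Prop where
  continuousOn : ContinuousOn ℓ S
  exp_eq : ∀ x ∈ S, Complex.exp (ℓ x) = g x

/-- A convex set is contractible and locally path connected, so `g` lifts through the covering `exp
: ℂ → ℂ \ {0}`. -/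
theorem exists_isLog {E : Type*} [NormedAddCommGroup E] [NormedSpace ℝ E] {S : Set E}
    (hS : Convex ℝ S) {g : E → ℂ} (hg : ContinuousOn g S) (h0 : ∀ x ∈ S, g x ≠ 0) :
    ∃ ℓ, IsLog ℓ g S := by
  classical
  rcases S.eq_empty_or_nonempty with rfl | hne
  · exact ⟨0, by simp, by simp⟩
  have := hS.contractibleSpace hne
  have := hS.locallyPathConnectedSpace
  obtain ⟨x₀, hx₀⟩ := hne
  obtain ⟨F, ⟨-, hF⟩, -⟩ := Complex.isCoveringMapOn_exp.existsUnique_continuousMap_lifts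
    (⟨S.domRestrict g, hg.domRestrict⟩ : C(S, ℂ)) (a₀ := ⟨x₀, hx₀⟩) (e₀ := Complex.log (g x₀))
    (Complex.exp_log (h0 x₀ hx₀)) (fun a => h0 a a.2)
  refine ⟨fun x => if h : x ∈ S then F ⟨x, h⟩ else 0, ?_, fun x hx => ?_⟩
  · rw [continuousOn_iff_continuous_domRestrict]
    convert! F.continuous using 1
    ext x
    simp
  · rw [dif_pos hx]
    exact congrFun hF ⟨x, hx⟩

namespace IsLog

variable {E E' : Type*} [TopologicalSpace E] [TopologicalSpace E'] {S T : Set E}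
  {ℓ ℓ' g g' : E → ℂ}

theorem mono (h : IsLog ℓ g S) (hT : T ⊆ S) : IsLog ℓ g T :=
  ⟨h.continuousOn.mono hT, fun x hx => h.exp_eq x (hT hx)⟩

theorem congr (h : IsLog ℓ g S) (hg : ∀ x ∈ S, g x = g' x) : IsLog ℓ g' S :=
  ⟨h.continuousOn, fun x hx => (h.exp_eq x hx).trans (hg x hx)⟩

theorem mul (h : IsLog ℓ g S) (h' : IsLog ℓ' g' S) :
    IsLog (fun x => ℓ x + ℓ' x) (fun x => g x * g' x) S :=
  ⟨h.continuousOn.add h'.continuousOn, fun x hx => by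
    rw [Complex.exp_add, h.exp_eq x hx, h'.exp_eq x hx]⟩

theorem conj (h : IsLog ℓ g S) :
    IsLog (fun x => (starRingEnd ℂ) (ℓ x)) (fun x => (starRingEnd ℂ) (g x)) S :=
  ⟨Complex.continuous_conj.comp_continuousOn h.continuousOn, fun x hx => by
    rw [Complex.exp_conj, h.exp_eq x hx]⟩

theorem comp (h : IsLog ℓ g S) {φ : E' → E} {U : Set E'} (hφ : ContinuousOn φ U)
    (hm : MapsTo φ U S) : IsLog (fun x => ℓ (φ x)) (fun x => g (φ x)) U :=
  ⟨h.continuousOn.comp hφ hm, fun _ hx => h.exp_eq _ (hm hx)⟩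

theorem log (hg : ContinuousOn g S) (hs : ∀ x ∈ S, g x ∈ Complex.slitPlane) :
    IsLog (fun x => Complex.log (g x)) g S :=
  ⟨hg.clog hs, fun x hx => Complex.exp_log (Complex.slitPlane_ne_zero (hs x hx))⟩

theorem const {c : ℂ} (hc : c ≠ 0) : IsLog (fun _ : E => Complex.log c) (fun _ => c) S :=
  ⟨continuousOn_const, fun _ _ => Complex.exp_log hc⟩

/-- Two logarithms of one function differ by a continuous function with values in the discrete group
`2πiℤ`, which is constant on a preconnected set. -/
theorem sub_eq_sub (h : IsLog ℓ g S) (h' : IsLog ℓ' g S) (hS : IsPreconnected S) {x y : E}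
    (hx : x ∈ S) (hy : y ∈ S) : ℓ y - ℓ x = ℓ' y - ℓ' x := by
  have hd : IsDiscrete ((AddSubgroup.zmultiples (2 * Real.pi * Complex.I) : AddSubgroup ℂ) :
      Set ℂ) := ⟨NormedSpace.discreteTopology_zmultiples _⟩
  have := hS.constant_of_mapsTo hd (h.continuousOn.sub h'.continuousOn) (fun z hz => ?_) hx hy
  · simp only [Pi.sub_apply] at this
    linear_combination -this
  · have h1 : Complex.exp (ℓ z) = Complex.exp (ℓ' z) := by
      rw [h.exp_eq z hz, h'.exp_eq z hz]
    obtain ⟨n, hn⟩ := Complex.exp_eq_exp_iff_exists_int.1 h1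
    exact AddSubgroup.mem_zmultiples_iff.2 ⟨n, by rw [Pi.sub_apply, hn]; simp⟩

end IsLog

open Classical in
/-- The variation of a continuous logarithm of `g` along `[x, y]`. -/
def logVar (g : ℝ → ℂ) (x y : ℝ) : ℂ :=
  if h : ∃ ℓ, IsLog ℓ g (Icc x y) then h.choose y - h.choose x else 0

section logVar

variable {g g' ℓ : ℝ → ℂ} {x y : ℝ}

/-- By `IsLog.sub_eq_sub` the logarithm chosen in `logVar` may be replaced by whichever one is at
hand. -/
theorem IsLog.logVar_eq (h : IsLog ℓ g (Icc x y)) (hxy : x ≤ y) : logVar g x y = ℓ y - ℓ x := by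
  have he : ∃ ℓ, IsLog ℓ g (Icc x y) := ⟨ℓ, h⟩
  rw [logVar, dif_pos he]
  exact he.choose_spec.sub_eq_sub h isPreconnected_Icc (left_mem_Icc.2 hxy) (right_mem_Icc.2 hxy)

theorem exists_isLog_Icc (hg : ContinuousOn g (Icc x y)) (h0 : ∀ z ∈ Icc x y, g z ≠ 0) :
    ∃ ℓ, IsLog ℓ g (Icc x y) := exists_isLog (convex_Icc x y) hg h0

-- Functions that agree on the interval have the same logarithms there, so the definition makes the
-- same choice; neither continuity nor nonvanishing is needed.
open Classical in
theorem logVar_congr (h : ∀ z ∈ Icc x y, g z = g' z) : logVar g x y = logVar g' x y := by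
  have key : (fun ℓ => IsLog ℓ g (Icc x y)) = fun ℓ => IsLog ℓ g' (Icc x y) := by
    ext ℓ
    exact ⟨fun hl => hl.congr h, fun hl => hl.congr fun z hz => (h z hz).symm⟩
  exact congrArg (fun P : (ℝ → ℂ) → Prop =>
    if h : ∃ ℓ, P ℓ then h.choose y - h.choose x else 0) key

theorem logVar_mul (hxy : x ≤ y) (hg : ContinuousOn g (Icc x y)) (h0 : ∀ z ∈ Icc x y, g z ≠ 0)
    (hg' : ContinuousOn g' (Icc x y)) (h0' : ∀ z ∈ Icc x y, g' z ≠ 0) :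
    logVar (fun z => g z * g' z) x y = logVar g x y + logVar g' x y := by
  obtain ⟨ℓ, hl⟩ := exists_isLog_Icc hg h0
  obtain ⟨ℓ', hl'⟩ := exists_isLog_Icc hg' h0'
  rw [(hl.mul hl').logVar_eq hxy, hl.logVar_eq hxy, hl'.logVar_eq hxy]
  ring

theorem logVar_conj (hxy : x ≤ y) (hg : ContinuousOn g (Icc x y))
    (h0 : ∀ z ∈ Icc x y, g z ≠ 0) :
    logVar (fun z => (starRingEnd ℂ) (g z)) x y = (starRingEnd ℂ) (logVar g x y) := by
  obtain ⟨ℓ, hl⟩ := exists_isLog_Icc hg h0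
  rw [hl.conj.logVar_eq hxy, hl.logVar_eq hxy]
  simp

theorem logVar_of_slitPlane (hxy : x ≤ y) (hg : ContinuousOn g (Icc x y))
    (hs : ∀ z ∈ Icc x y, g z ∈ Complex.slitPlane) :
    logVar g x y = Complex.log (g y) - Complex.log (g x) := (IsLog.log hg hs).logVar_eq hxy

theorem exp_logVar (hxy : x ≤ y) (hg : ContinuousOn g (Icc x y)) (h0 : ∀ z ∈ Icc x y, g z ≠ 0) :
    Complex.exp (logVar g x y) = g y / g x := by
  obtain ⟨ℓ, hl⟩ := exists_isLog_Icc hg h0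
  rw [hl.logVar_eq hxy, Complex.exp_sub, hl.exp_eq y (right_mem_Icc.2 hxy),
    hl.exp_eq x (left_mem_Icc.2 hxy)]

theorem logVar_const (hxy : x ≤ y) {c : ℂ} (hc : c ≠ 0) : logVar (fun _ => c) x y = 0 := by
  rw [(IsLog.const hc).logVar_eq hxy, sub_self]

/-- The variation of the logarithm along a closed loop does not change if the loop is composed with
an orientation-preserving real linear automorphism of the plane. -/
theorem logVar_linear (hxy : x ≤ y) (hg : ContinuousOn g (Icc x y))
    (h0 : ∀ z ∈ Icc x y, g z ≠ 0) (hc : g x = g y) {α β : ℂ} (hαβ : ‖β‖ < ‖α‖) :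
    logVar (fun z => α * g z + β * (starRingEnd ℂ) (g z)) x y = logVar g x y := by
  have hα : α ≠ 0 := by rintro rfl; simp at hαβ; linarith [norm_nonneg β]
  have hcg : ContinuousOn (fun z => (starRingEnd ℂ) (g z)) (Icc x y) :=
    Complex.continuous_conj.comp_continuousOn hg
  -- Write `α g + β conj g = α * g * q`. Then `|q - 1| < 1`, so the principal logarithm serves for
  -- `q`, and its variation vanishes because `g` has equal values at the ends.
  set q : ℝ → ℂ := fun z => 1 + β / α * ((starRingEnd ℂ) (g z) / g z) with hq
  have hqc : ContinuousOn q (Icc x y) :=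
    continuousOn_const.add (continuousOn_const.mul (hcg.div hg h0))
  have hqs : ∀ z ∈ Icc x y, q z ∈ Complex.slitPlane := fun z hz => by
    refine Complex.mem_slitPlane_of_norm_lt_one ?_
    have : ‖g z‖ ≠ 0 := norm_ne_zero_iff.2 (h0 z hz)
    rw [norm_mul, norm_div, norm_div, Complex.norm_conj, div_self this, mul_one]
    exact (div_lt_one (norm_pos_iff.2 hα)).2 hαβ
  have h1 : ∀ z ∈ Icc x y, α * g z + β * (starRingEnd ℂ) (g z) = α * (g z * q z) := fun z hz => by
    have := h0 z hz
    simp only [hq]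
    field_simp
  rw [logVar_congr h1, logVar_mul hxy continuousOn_const (fun _ _ => hα)
    (g' := fun z => g z * q z) (hg.mul hqc)
    (fun z hz => mul_ne_zero (h0 z hz) (Complex.slitPlane_ne_zero (hqs z hz))),
    logVar_mul hxy hg h0 hqc (fun z hz => Complex.slitPlane_ne_zero (hqs z hz)),
    logVar_const hxy hα, logVar_of_slitPlane hxy hqc hqs]
  simp [hq, hc]

end logVar

/-! ### The degree formula on a rectangle -/

/-- The boundary of a rectangle. -/
def rectBoundary (a b c d : ℝ) : Set (ℝ × ℝ) := (Icc a b ×ˢ Icc c d) \ (Ioo a b ×ˢ Ioo c d)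

/-- The variation of the logarithm of `F` along the boundary of a rectangle. -/
def boundaryVar (F : ℝ × ℝ → ℂ) (a b c d : ℝ) : ℂ :=
  logVar (fun s => F (s, c)) a b + logVar (fun t => F (b, t)) c d
    - logVar (fun s => F (s, d)) a b - logVar (fun t => F (a, t)) c d

section boundaryVar

variable {F G ℓ : ℝ × ℝ → ℂ} {a b c d : ℝ}

theorem mapsTo_bottom (hcd : c ≤ d) : MapsTo (fun s => (s, c)) (Icc a b) (rectBoundary a b c d) :=
  fun _ hs => ⟨⟨hs, le_rfl, hcd⟩, fun h => lt_irrefl _ h.2.1⟩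

theorem mapsTo_top (hcd : c ≤ d) : MapsTo (fun s => (s, d)) (Icc a b) (rectBoundary a b c d) :=
  fun _ hs => ⟨⟨hs, hcd, le_rfl⟩, fun h => lt_irrefl _ h.2.2⟩

theorem mapsTo_left (hab : a ≤ b) : MapsTo (fun t => (a, t)) (Icc c d) (rectBoundary a b c d) :=
  fun _ ht => ⟨⟨⟨le_rfl, hab⟩, ht⟩, fun h => lt_irrefl _ h.1.1⟩

theorem mapsTo_right (hab : a ≤ b) : MapsTo (fun t => (b, t)) (Icc c d) (rectBoundary a b c d) :=
  fun _ ht => ⟨⟨⟨hab, le_rfl⟩, ht⟩, fun h => lt_irrefl _ h.1.2⟩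

theorem boundaryVar_congr (hab : a ≤ b) (hcd : c ≤ d)
    (h : ∀ z ∈ rectBoundary a b c d, F z = G z) : boundaryVar F a b c d = boundaryVar G a b c d := by
  unfold boundaryVar
  rw [logVar_congr fun s hs => h _ (mapsTo_bottom hcd hs),
    logVar_congr fun s hs => h _ (mapsTo_right hab hs),
    logVar_congr fun s hs => h _ (mapsTo_top hcd hs),
    logVar_congr fun s hs => h _ (mapsTo_left hab hs)]

theorem boundaryVar_mul (hab : a ≤ b) (hcd : c ≤ d) (hF : ContinuousOn F (rectBoundary a b c d))
    (hF0 : ∀ z ∈ rectBoundary a b c d, F z ≠ 0) (hG : ContinuousOn G (rectBoundary a b c d))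
    (hG0 : ∀ z ∈ rectBoundary a b c d, G z ≠ 0) :
    boundaryVar (fun z => F z * G z) a b c d = boundaryVar F a b c d + boundaryVar G a b c d := by
  unfold boundaryVar
  rw [logVar_mul (g := fun s => F (s, c)) (g' := fun s => G (s, c)) hab
      (hF.comp (by fun_prop) (mapsTo_bottom hcd))
      (fun s hs => hF0 _ (mapsTo_bottom hcd hs)) (hG.comp (by fun_prop) (mapsTo_bottom hcd))
      (fun s hs => hG0 _ (mapsTo_bottom hcd hs)),
    logVar_mul (g := fun t => F (b, t)) (g' := fun t => G (b, t)) hcd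
      (hF.comp (by fun_prop) (mapsTo_right hab))
      (fun s hs => hF0 _ (mapsTo_right hab hs)) (hG.comp (by fun_prop) (mapsTo_right hab))
      (fun s hs => hG0 _ (mapsTo_right hab hs)),
    logVar_mul (g := fun s => F (s, d)) (g' := fun s => G (s, d)) hab
      (hF.comp (by fun_prop) (mapsTo_top hcd))
      (fun s hs => hF0 _ (mapsTo_top hcd hs)) (hG.comp (by fun_prop) (mapsTo_top hcd))
      (fun s hs => hG0 _ (mapsTo_top hcd hs)),
    logVar_mul (g := fun t => F (a, t)) (g' := fun t => G (a, t)) hcd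
      (hF.comp (by fun_prop) (mapsTo_left hab))
      (fun s hs => hF0 _ (mapsTo_left hab hs)) (hG.comp (by fun_prop) (mapsTo_left hab))
      (fun s hs => hG0 _ (mapsTo_left hab hs))]
  ring

theorem IsLog.boundaryVar_eq_zero (hab : a ≤ b) (hcd : c ≤ d)
    (h : IsLog ℓ F (rectBoundary a b c d)) : boundaryVar F a b c d = 0 := by
  unfold boundaryVar
  rw [(h.comp (by fun_prop) (mapsTo_bottom hcd)).logVar_eq hab,
    (h.comp (by fun_prop) (mapsTo_right hab)).logVar_eq hcd,
    (h.comp (by fun_prop) (mapsTo_top hcd)).logVar_eq hab,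
    (h.comp (by fun_prop) (mapsTo_left hab)).logVar_eq hcd]
  ring

/-- A nonvanishing function on the full rectangle has one logarithm for all four sides, and its
corner values cancel. -/
theorem boundaryVar_eq_zero (hab : a ≤ b) (hcd : c ≤ d) (hF : ContinuousOn F (Icc a b ×ˢ Icc c d))
    (hF0 : ∀ z ∈ Icc a b ×ˢ Icc c d, F z ≠ 0) : boundaryVar F a b c d = 0 := by
  obtain ⟨ℓ, h⟩ := exists_isLog ((convex_Icc a b).prod (convex_Icc c d)) hF hF0
  exact (h.mono sdiff_subset).boundaryVar_eq_zero hab hcd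

theorem boundaryVar_conj (hab : a ≤ b) (hcd : c ≤ d) (hF : ContinuousOn F (rectBoundary a b c d))
    (hF0 : ∀ z ∈ rectBoundary a b c d, F z ≠ 0) :
    boundaryVar (fun z => (starRingEnd ℂ) (F z)) a b c d =
      (starRingEnd ℂ) (boundaryVar F a b c d) := by
  unfold boundaryVar
  rw [logVar_conj (g := fun s => F (s, c)) hab (hF.comp (by fun_prop) (mapsTo_bottom hcd))
      (fun s hs => hF0 _ (mapsTo_bottom hcd hs)),
    logVar_conj (g := fun t => F (b, t)) hcd (hF.comp (by fun_prop) (mapsTo_right hab))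
      (fun s hs => hF0 _ (mapsTo_right hab hs)),
    logVar_conj (g := fun s => F (s, d)) hab (hF.comp (by fun_prop) (mapsTo_top hcd))
      (fun s hs => hF0 _ (mapsTo_top hcd hs)),
    logVar_conj (g := fun t => F (a, t)) hcd (hF.comp (by fun_prop) (mapsTo_left hab))
      (fun s hs => hF0 _ (mapsTo_left hab hs))]
  simp

/-- If a constant multiple of `g` has positive real part, then its principal logarithm computes the
variation. -/
theorem logVar_of_re_pos {g : ℝ → ℂ} {x y : ℝ} (hxy : x ≤ y) (hg : ContinuousOn g (Icc x y))
    {k : ℂ} (hk : k ≠ 0) (hs : ∀ z ∈ Icc x y, 0 < (k * g z).re) :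
    logVar g x y = Complex.log (k * g y) - Complex.log (k * g x) := by
  have h0 : ∀ z ∈ Icc x y, g z ≠ 0 := fun z hz h => by simpa [h] using hs z hz
  rw [← logVar_of_slitPlane (g := fun z => k * g z) hxy (continuousOn_const.mul hg)
    (fun z hz => Or.inl (hs z hz)),
    logVar_mul hxy continuousOn_const (fun _ _ => hk) hg h0, logVar_const hxy hk, zero_add]

/-- The argument is less than `π/2`, so a quarter turn does not cross the branch cut. -/
theorem log_I_mul {z : ℂ} (h : 0 < z.re) :
    Complex.log (Complex.I * z) = Complex.log z + Real.pi / 2 * Complex.I := by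
  have hz : z ≠ 0 := fun hz => by simp [hz] at h
  have h1 := Complex.abs_arg_lt_pi_div_two_iff.2 (Or.inl h)
  rw [abs_lt] at h1
  rw [mul_comm, Complex.log_mul hz Complex.I_ne_zero, Complex.log_I]
  rw [Complex.arg_I]
  constructor <;> linarith [Real.pi_pos]

/-- The winding number of the boundary of a rectangle around an inner point is one. -/
theorem boundaryVar_sub {z : ℝ × ℝ} (hz : z ∈ Ioo a b ×ˢ Ioo c d) :
    boundaryVar (fun u => ((u.1 - z.1 : ℝ) : ℂ) + (u.2 - z.2 : ℝ) * Complex.I) a b c d =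
      2 * Real.pi * Complex.I := by
  obtain ⟨⟨h1, h2⟩, h3, h4⟩ := hz
  have hab : a ≤ b := (h1.trans h2).le
  have hcd : c ≤ d := (h3.trans h4).le
  have hI := Complex.I_ne_zero
  unfold boundaryVar
  -- The factors `I`, `1`, `-I`, `-1` turn the bottom, right, top and left sides into the right
  -- half-plane.
  rw [logVar_of_re_pos hab (by fun_prop) hI (fun s hs => by simpa using h3),
    logVar_of_re_pos hcd (by fun_prop) one_ne_zero (fun s hs => by simpa using h2),
    logVar_of_re_pos hab (by fun_prop) (neg_ne_zero.2 hI) (fun s hs => by simpa using h4),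
    logVar_of_re_pos hcd (by fun_prop) (neg_ne_zero.2 one_ne_zero)
      (fun s hs => by simpa using h1)]
  simp only
  set SW : ℂ := ((a - z.1 : ℝ) : ℂ) + (c - z.2 : ℝ) * Complex.I with hSW
  set SE : ℂ := ((b - z.1 : ℝ) : ℂ) + (c - z.2 : ℝ) * Complex.I with hSE
  set NW : ℂ := ((a - z.1 : ℝ) : ℂ) + (d - z.2 : ℝ) * Complex.I with hNW
  set NE : ℂ := ((b - z.1 : ℝ) : ℂ) + (d - z.2 : ℝ) * Complex.I with hNE
  -- At each corner the principal logarithms of the two adjacent sides differ by `πi/2`; the four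
  -- corners together give `2πi`.
  have e1 := log_I_mul (z := SE) (by simpa [hSE] using h2)
  have e2 := log_I_mul (z := -Complex.I * NE) (by simpa [hNE] using h4)
  have e3 := log_I_mul (z := -NW) (by simpa [hNW] using h1)
  have e4 := log_I_mul (z := Complex.I * SW) (by simpa [hSW] using h3)
  have r2 : Complex.I * (-Complex.I * NE) = 1 * NE := by ring_nf; simp
  have r3 : Complex.I * -NW = -Complex.I * NW := by ring
  have r4 : Complex.I * (Complex.I * SW) = -1 * SW := by ring_nf; simp
  rw [r2] at e2
  rw [r3] at e3
  rw [r4] at e4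
  rw [e1, e2, e3, e4, show -1 * NW = -NW by ring, one_mul]
  ring

/-- The real linear map with partial derivatives `v` and `w`. -/
def planeLinear (v w : ℂ) (u : ℝ × ℝ) : ℂ := u.1 * v + u.2 * w

theorem continuous_planeLinear (v w : ℂ) : Continuous (planeLinear v w) := by
  unfold planeLinear; fun_prop

/-- The determinant of the real linear map with partial derivatives `v` and `w`. -/
def planeDet (v w : ℂ) : ℝ := v.re * w.im - v.im * w.re

theorem planeLinear_ne_zero {v w : ℂ} (h : planeDet v w ≠ 0) {u : ℝ × ℝ} (hu : u ≠ 0) :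
    planeLinear v w u ≠ 0 := by
  intro h0
  have hr := congrArg Complex.re h0
  have hi := congrArg Complex.im h0
  simp only [planeLinear, Complex.add_re, Complex.re_ofReal_mul, Complex.zero_re, Complex.add_im,
    Complex.im_ofReal_mul, Complex.zero_im] at hr hi
  unfold planeDet at h
  apply hu
  ext
  · refine (mul_eq_zero.1 (?_ : u.1 * _ = 0)).resolve_right h
    linear_combination w.im * hr - w.re * hi
  · refine (mul_eq_zero.1 (?_ : u.2 * _ = 0)).resolve_right h
    linear_combination v.re * hi - v.im * hr

theorem boundaryVar_const (hab : a ≤ b) (hcd : c ≤ d) {k : ℂ} (hk : k ≠ 0) :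
    boundaryVar (fun _ => k) a b c d = 0 := by
  simp [boundaryVar, logVar_const hab hk, logVar_const hcd hk]

/-- As in `logVar_linear`; here the correcting factor `q` has its principal logarithm on the whole
boundary and contributes nothing. -/
theorem boundaryVar_dominant (hab : a ≤ b) (hcd : c ≤ d) {α β : ℂ}
    (hαβ : ‖β‖ < ‖α‖) (hF : ContinuousOn F (rectBoundary a b c d))
    (hF0 : ∀ z ∈ rectBoundary a b c d, F z ≠ 0) :
    boundaryVar (fun u => α * F u + β * (starRingEnd ℂ) (F u)) a b c d =
      boundaryVar F a b c d := by
  have hα : α ≠ 0 := by rintro rfl; simp at hαβ; linarith [norm_nonneg β]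
  have hcF : ContinuousOn (fun z => (starRingEnd ℂ) (F z)) (rectBoundary a b c d) :=
    Complex.continuous_conj.comp_continuousOn hF
  set q : ℝ × ℝ → ℂ := fun z => 1 + β / α * ((starRingEnd ℂ) (F z) / F z) with hq
  have hqc : ContinuousOn q (rectBoundary a b c d) :=
    continuousOn_const.add (continuousOn_const.mul (hcF.div hF hF0))
  have hqs : ∀ z ∈ rectBoundary a b c d, q z ∈ Complex.slitPlane := fun z hz => by
    refine Complex.mem_slitPlane_of_norm_lt_one ?_
    have : ‖F z‖ ≠ 0 := norm_ne_zero_iff.2 (hF0 z hz)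
    rw [norm_mul, norm_div, norm_div, Complex.norm_conj, div_self this, mul_one]
    exact (div_lt_one (norm_pos_iff.2 hα)).2 hαβ
  have h1 : ∀ z ∈ rectBoundary a b c d,
      α * F z + β * (starRingEnd ℂ) (F z) = α * (F z * q z) := fun z hz => by
    have := hF0 z hz
    simp only [hq]
    field_simp
  rw [boundaryVar_congr hab hcd h1, boundaryVar_mul hab hcd continuousOn_const (fun _ _ => hα)
    (G := fun z => F z * q z) (hF.mul hqc)
    (fun z hz => mul_ne_zero (hF0 z hz) (Complex.slitPlane_ne_zero (hqs z hz))),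
    boundaryVar_mul hab hcd hF hF0 hqc (fun z hz => Complex.slitPlane_ne_zero (hqs z hz)),
    boundaryVar_const hab hcd hα, (IsLog.log hqc hqs).boundaryVar_eq_zero hab hcd]
  simp

/-- A real linear map of the plane is `α ζ + β conj ζ`, with determinant `|α|² - |β|²`. The sign of
the determinant decides which term dominates: `ζ` makes one turn, `conj ζ` makes minus one. -/
theorem boundaryVar_planeLinear {z : ℝ × ℝ} (hz : z ∈ Ioo a b ×ˢ Ioo c d) {v w : ℂ}
    (h : planeDet v w ≠ 0) :
    boundaryVar (fun u => planeLinear v w (u - z)) a b c d =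
      2 * Real.pi * Complex.I * (SignType.sign (planeDet v w) : ℤ) := by
  have hab : a ≤ b := (hz.1.1.trans hz.1.2).le
  have hcd : c ≤ d := (hz.2.1.trans hz.2.2).le
  set F : ℝ × ℝ → ℂ := fun u => ((u.1 - z.1 : ℝ) : ℂ) + (u.2 - z.2 : ℝ) * Complex.I with hFdef
  have hF : ContinuousOn F (rectBoundary a b c d) := by fun_prop
  have hF0 : ∀ u ∈ rectBoundary a b c d, F u ≠ 0 := fun u hu h0 => hu.2 <| by
    have hr := congrArg Complex.re h0
    have hi := congrArg Complex.im h0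
    simp [hFdef] at hr hi
    have : u = z := Prod.ext (by linarith) (by linarith)
    rwa [this]
  set α : ℂ := (v - w * Complex.I) / 2 with hα
  set β : ℂ := (v + w * Complex.I) / 2 with hβ
  have hlin : (fun u => planeLinear v w (u - z)) =
      fun u => α * F u + β * (starRingEnd ℂ) (F u) := by
    ext u
    simp only [planeLinear, hFdef, hα, hβ, Prod.fst_sub, Prod.snd_sub, map_add, map_mul,
      Complex.conj_ofReal, Complex.conj_I]
    ring_nf
    simp
  have hnorm : ‖α‖ ^ 2 - ‖β‖ ^ 2 = planeDet v w := by
    rw [← Complex.normSq_eq_norm_sq, ← Complex.normSq_eq_norm_sq, Complex.normSq_apply,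
      Complex.normSq_apply, hα, hβ]
    simp [planeDet]
    ring
  have hFv := boundaryVar_sub hz
  rw [hlin]
  rcases lt_or_gt_of_ne h with hneg | hpos
  · have hlt : ‖α‖ < ‖β‖ := by
      refine lt_of_pow_lt_pow_left₀ 2 (norm_nonneg _) ?_
      linarith
    have hc : ContinuousOn (fun u => (starRingEnd ℂ) (F u)) (rectBoundary a b c d) :=
      Complex.continuous_conj.comp_continuousOn hF
    have := boundaryVar_dominant hab hcd hlt hc
      (fun u hu => (map_ne_zero _).2 (hF0 u hu))
    rw [boundaryVar_conj hab hcd hF hF0, hFv] at this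
    simp only [Complex.conj_conj] at this
    rw [show (fun u => α * F u + β * (starRingEnd ℂ) (F u)) =
      fun u => β * (starRingEnd ℂ) (F u) + α * F u by ext u; ring, this, sign_neg hneg]
    simp [map_ofNat]
  · have hlt : ‖β‖ < ‖α‖ := by
      refine lt_of_pow_lt_pow_left₀ 2 (norm_nonneg _) ?_
      linarith
    rw [boundaryVar_dominant hab hcd hlt hF hF0, hFv, sign_pos hpos]
    simp

/-- The number of turns of `F` along the boundary of a rectangle is the signed number of its
zeros in the rectangle, if these are finitely many and nondegenerate. -/
theorem boundaryVar_eq_sum_aux (hab : a < b) (hcd : c < d) (v w : ℝ × ℝ → ℂ)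
    (Z : Finset (ℝ × ℝ)) : ∀ F : ℝ × ℝ → ℂ, ContinuousOn F (Icc a b ×ˢ Icc c d) →
    (∀ z ∈ Z, z ∈ Ioo a b ×ˢ Ioo c d) → (∀ z ∈ Icc a b ×ˢ Icc c d, F z = 0 ↔ z ∈ Z) →
    (∀ z ∈ Z, planeDet (v z) (w z) ≠ 0) →
    (∀ z ∈ Z, ∃ k ≠ 0, Tendsto (fun u => F u / planeLinear (v z) (w z) (u - z)) (𝓝[≠] z) (𝓝 k)) →
    boundaryVar F a b c d =
      2 * Real.pi * Complex.I * ((∑ z ∈ Z, (SignType.sign (planeDet (v z) (w z)) : ℤ) : ℤ) : ℂ) := by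
  classical
  induction Z using Finset.induction_on with
  | empty =>
    intro F hF _ h0 _ _
    simp only [Finset.notMem_empty, iff_false] at h0
    simp [boundaryVar_eq_zero hab.le hcd.le hF h0]
  | insert z Z hz ih =>
    intro F hF hin h0 hdet hlim
    obtain ⟨k, hk, hkl⟩ := hlim z (Finset.mem_insert_self _ _)
    have hzin := hin z (Finset.mem_insert_self _ _)
    have hzdet := hdet z (Finset.mem_insert_self _ _)
    set L : ℝ × ℝ → ℂ := fun u => planeLinear (v z) (w z) (u - z) with hL
    have hLc : Continuous L := (continuous_planeLinear _ _).comp (continuous_id.sub continuous_const)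
    have hL0 : ∀ u, u ≠ z → L u ≠ 0 := fun u hu =>
      planeLinear_ne_zero hzdet (sub_ne_zero.2 hu)
    -- Dividing by the linear part at `z` and filling in the limit removes this zero. At the other
    -- zeros the limit only gets multiplied by a nonzero complex number; this is why the induction
    -- allows any limit `k ≠ 0` and can keep `v` and `w`.
    set G : ℝ × ℝ → ℂ := Function.update (fun u => F u / L u) z k with hG
    have hGne : ∀ u, u ≠ z → G u = F u / L u := fun u hu => Function.update_of_ne hu _ _
    have hGz : G z = k := Function.update_self _ _ _
    have hGev : ∀ u, u ≠ z → G =ᶠ[𝓝 u] fun u => F u / L u := fun u hu => by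
      filter_upwards [isOpen_ne.mem_nhds hu] with y hy using hGne y hy
    have hGc : ContinuousOn G (Icc a b ×ˢ Icc c d) := by
      intro u hu
      by_cases huz : u = z
      · subst huz
        refine ContinuousAt.continuousWithinAt ?_
        rw [hG, continuousAt_update_same]
        exact hkl
      · refine ContinuousWithinAt.congr_of_eventuallyEq (f := fun u => F u / L u) ?_
          ((hGev u huz).filter_mono nhdsWithin_le_nhds) (hGne u huz)
        exact (hF u hu).div hLc.continuousWithinAt (hL0 u huz)
    have hG0 : ∀ u ∈ Icc a b ×ˢ Icc c d, G u = 0 ↔ u ∈ Z := by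
      intro u hu
      by_cases huz : u = z
      · subst huz
        rw [hGz]
        exact ⟨fun h => absurd h hk, fun h => absurd h hz⟩
      · rw [hGne u huz, div_eq_zero_iff, or_iff_left (hL0 u huz), h0 u hu, Finset.mem_insert,
          or_iff_right huz]
    have hGlim : ∀ y ∈ Z, ∃ k ≠ 0,
        Tendsto (fun u => G u / planeLinear (v y) (w y) (u - y)) (𝓝[≠] y) (𝓝 k) := by
      intro y hy
      have hyz : y ≠ z := fun h => hz (h ▸ hy)
      obtain ⟨k', hk', hkl'⟩ := hlim y (Finset.mem_insert_of_mem hy)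
      refine ⟨k' / L y, div_ne_zero hk' (hL0 y hyz), ?_⟩
      have h1 : Tendsto L (𝓝[≠] y) (𝓝 (L y)) := hLc.continuousAt.mono_left nhdsWithin_le_nhds
      refine (hkl'.div h1 (hL0 y hyz)).congr' ?_
      filter_upwards [(hGev y hyz).filter_mono nhdsWithin_le_nhds] with u hu
      rw [hu]
      simp only [Pi.div_apply]
      ring
    have hbd : ∀ u ∈ rectBoundary a b c d, u ≠ z := fun u hu h => hu.2 (h ▸ hzin)
    have hFG : ∀ u ∈ rectBoundary a b c d, F u = G u * L u := fun u hu => by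
      rw [hGne u (hbd u hu), div_mul_cancel₀ _ (hL0 u (hbd u hu))]
    rw [boundaryVar_congr hab.le hcd.le hFG,
      boundaryVar_mul hab.le hcd.le (hGc.mono sdiff_subset) (fun u hu h => hu.2 ?_)
      hLc.continuousOn (fun u hu => hL0 u (hbd u hu)),
      ih G hGc (fun y hy => hin y (Finset.mem_insert_of_mem hy)) hG0
        (fun y hy => hdet y (Finset.mem_insert_of_mem hy)) hGlim,
      boundaryVar_planeLinear hzin hzdet, Finset.sum_insert hz]
    · push_cast; ring
    · exact hin u (Finset.mem_insert_of_mem ((hG0 u hu.1).1 h))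

/-- A function with nondegenerate derivative is asymptotic to it. -/
theorem tendsto_div_planeLinear {z : ℝ × ℝ} {v w : ℂ} {F' : ℝ × ℝ →L[ℝ] ℂ}
    (hF : HasFDerivAt F F' z) (hF' : ∀ u, F' u = planeLinear v w u) (hz : F z = 0)
    (h : planeDet v w ≠ 0) :
    Tendsto (fun u => F u / planeLinear v w (u - z)) (𝓝[≠] z) (𝓝 1) := by
  have hinj : LinearMap.ker F'.toLinearMap = ⊥ := by
    rw [LinearMap.ker_eq_bot']
    intro u hu
    by_contra h0
    exact planeLinear_ne_zero h h0 (by rw [← hF']; exact hu)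
  -- An injective linear map in finite dimension is bounded below, so a remainder `o(u - z)` is also
  -- `o(F' (u - z))`.
  obtain ⟨K, hK, hanti⟩ := LinearMap.exists_antilipschitzWith F'.toLinearMap hinj
  have hO : (fun u => u - z) =O[𝓝 z] fun u => F' (u - z) := by
    refine Asymptotics.IsBigO.of_bound K (Eventually.of_forall fun u => ?_)
    have := hanti.le_mul_norm_sub (u - z) 0
    simpa [norm_sub_rev] using this
  have ho := hF.isLittleO.trans_isBigO hO
  have := ho.tendsto_div_nhds_zero
  have h2 : Tendsto (fun u => (F u - F z - F' (u - z)) / F' (u - z) + 1) (𝓝[≠] z) (𝓝 (0 + 1)) :=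
    (this.mono_left nhdsWithin_le_nhds).add tendsto_const_nhds
  rw [zero_add] at h2
  refine h2.congr' ?_
  filter_upwards [self_mem_nhdsWithin] with u hu
  have hne := planeLinear_ne_zero h (sub_ne_zero.2 hu)
  rw [hF', hz]
  field_simp
  ring

theorem boundaryVar_eq_sum (hab : a < b) (hcd : c < d) (v w : ℝ × ℝ → ℂ)
    (Z : Finset (ℝ × ℝ)) (hF : ContinuousOn F (Icc a b ×ˢ Icc c d))
    (hin : ∀ z ∈ Z, z ∈ Ioo a b ×ˢ Ioo c d) (h0 : ∀ z ∈ Icc a b ×ˢ Icc c d, F z = 0 ↔ z ∈ Z)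
    (hdet : ∀ z ∈ Z, planeDet (v z) (w z) ≠ 0)
    (hder : ∀ z ∈ Z, ∃ F' : ℝ × ℝ →L[ℝ] ℂ, HasFDerivAt F F' z ∧
      ∀ u, F' u = planeLinear (v z) (w z) u) :
    boundaryVar F a b c d =
      2 * Real.pi * Complex.I *
        ((∑ z ∈ Z, (SignType.sign (planeDet (v z) (w z)) : ℤ) : ℤ) : ℂ) := by
  refine boundaryVar_eq_sum_aux hab hcd v w Z F hF hin h0 hdet fun z hz => ⟨1, one_ne_zero, ?_⟩
  obtain ⟨F', hF', hlin⟩ := hder z hz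
  have hzin := hin z hz
  exact tendsto_div_planeLinear hF' hlin
    ((h0 z ⟨Ioo_subset_Icc_self hzin.1, Ioo_subset_Icc_self hzin.2⟩).2 hz) (hdet z hz)

end boundaryVar

/-! ### Vector algebra of three-space -/

theorem det3_eq (u v w : E3) : det3 u v w =
    u 0 * (v 1 * w 2 - v 2 * w 1) - u 1 * (v 0 * w 2 - v 2 * w 0)
      + u 2 * (v 0 * w 1 - v 1 * w 0) := by
  simp [det3, Matrix.det_fin_three]; ring

/-- The scalar product of three-space. -/
def dot3 (u v : E3) : ℝ := u 0 * v 0 + u 1 * v 1 + u 2 * v 2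

theorem dot3_self (u : E3) : dot3 u u = ‖u‖ ^ 2 := by
  rw [EuclideanSpace.norm_sq_eq, Fin.sum_univ_three]
  simp [dot3, sq]

theorem mem_S2_iff {P : E3} : P ∈ S2 ↔ dot3 P P = 1 := by
  rw [dot3_self, mem_sphere_zero_iff_norm]
  constructor
  · intro h; simp [h]
  · intro h; exact (pow_eq_one_iff_of_nonneg (norm_nonneg _) two_ne_zero).1 h

theorem dot3_sub_self_eq_zero {P Q : E3} : dot3 (P - Q) (P - Q) = 0 ↔ P = Q := by
  rw [dot3_self, pow_eq_zero_iff two_ne_zero, norm_eq_zero, sub_eq_zero]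

@[fun_prop]
theorem continuous_dot3 (u : E3) : Continuous (dot3 u) := by unfold dot3; fun_prop

theorem _root_.Continuous.det3 {X : Type*} [TopologicalSpace X] {f g h : X → E3}
    (hf : Continuous f) (hg : Continuous g) (hh : Continuous h) :
    Continuous fun x => det3 (f x) (g x) (h x) := by
  simp only [det3_eq]; fun_prop

theorem _root_.ContinuousOn.det3 {X : Type*} [TopologicalSpace X] {f g h : X → E3} {S : Set X}
    (hf : ContinuousOn f S) (hg : ContinuousOn g S) (hh : ContinuousOn h S) :
    ContinuousOn (fun x => det3 (f x) (g x) (h x)) S := by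
  simp only [det3_eq]; fun_prop

/-- Cramer's rule for the coordinates of `X` with respect to `u, w, d`, denominators cleared. -/
theorem det3_smul_eq (u w d X : E3) :
    det3 u w d • X = det3 X w d • u + det3 u X d • w + det3 u w X • d := by
  ext i
  simp only [det3_eq, PiLp.smul_apply, PiLp.add_apply, smul_eq_mul]
  fin_cases i <;> simp <;> ring

/-! ### Winding numbers around an axis -/

/-- The projection of three-space to the plane along `d`, up to a positive factor in the
coordinates given by `u` and `w`. -/
def axisProj (u w d : E3) : E3 →ₗ[ℝ] ℂ where
  toFun X := det3 X w d + det3 u X d * Complex.I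
  map_add' X Y := by
    simp only [det3_eq, PiLp.add_apply]
    push_cast
    ring
  map_smul' c X := by
    simp only [det3_eq, PiLp.smul_apply, smul_eq_mul, RingHom.id_apply, Complex.real_smul]
    push_cast
    ring

theorem axisProj_apply (u w d X : E3) :
    axisProj u w d X = det3 X w d + det3 u X d * Complex.I := rfl

theorem axisProj_axis (u w d : E3) : axisProj u w d d = 0 := by
  rw [axisProj_apply, show det3 d w d = 0 by rw [det3_eq]; ring,
    show det3 u d d = 0 by rw [det3_eq]; ring]
  simp

/-- Changing one positively oriented pair `u, w` to another acts on the plane across the axis with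
positive determinant; hence the winding number does not depend on the pair. -/
theorem planeDet_axisProj (u w d u' w' : E3) :
    planeDet (axisProj u w d u') (axisProj u w d w') = det3 u w d * det3 u' w' d := by
  simp [axisProj_apply, planeDet]
  simp only [det3_eq]
  ring

theorem axisProj_eq_zero {u w d X : E3} (h : 0 < det3 u w d) (hX : axisProj u w d X = 0) :
    ∃ k : ℝ, X = k • d := by
  have hr : det3 X w d = 0 := by simpa [axisProj_apply] using congrArg Complex.re hX
  have hi : det3 u X d = 0 := by simpa [axisProj_apply] using congrArg Complex.im hX
  refine ⟨det3 u w X / det3 u w d, ?_⟩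
  have := det3_smul_eq u w d X
  rw [hr, hi, zero_smul, zero_smul, zero_add, zero_add] at this
  rw [div_eq_inv_mul, mul_smul, ← this, smul_smul, inv_mul_cancel₀ h.ne', one_smul]

/-- The line through two points of the sphere meets the sphere in these points only. -/
theorem axisProj_ne_zero {u w p q P : E3} (h : 0 < det3 u w (p - q)) (hp : p ∈ S2) (hq : q ∈ S2)
    (hP : P ∈ S2) (hPp : P ≠ p) (hPq : P ≠ q) : axisProj u w (p - q) (P - p) ≠ 0 := by
  intro h0
  obtain ⟨k, hk⟩ := axisProj_eq_zero h h0
  have hpq : p ≠ q := by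
    rintro rfl
    rw [sub_self, det3_eq] at h
    simp at h
  have hP' : P = p + k • (p - q) := by rw [← hk]; abel
  rw [mem_S2_iff] at hp hq hP
  have hd : 0 < dot3 (p - q) (p - q) :=
    lt_of_le_of_ne (by rw [dot3_self]; positivity) fun h => hpq (dot3_sub_self_eq_zero.1 h.symm)
  have e1 : dot3 P P = dot3 p p + 2 * k * dot3 p (p - q) + k ^ 2 * dot3 (p - q) (p - q) := by
    rw [hP']
    simp [dot3]
    ring
  have e2 : 2 * dot3 p (p - q) = dot3 p p - dot3 q q + dot3 (p - q) (p - q) := by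
    simp [dot3]
    ring
  -- A point `p + k (p - q)` of the sphere satisfies a quadratic equation with the roots `k = 0`,
  -- which is `p`, and `k = -1`, which is `q`.
  have e3 : dot3 (p - q) (p - q) * (k * (k + 1)) = 0 := by
    linear_combination e1 * (-1) + hP - hp - k * e2 - k * (hp - hq)
  rcases mul_eq_zero.1 ((mul_eq_zero.1 e3).resolve_left hd.ne') with h | h
  · exact hPp (by rw [hP', h]; simp)
  · refine hPq ?_
    rw [hP', show k = -1 by linarith]
    simp

/-- In cylindrical coordinates `B (γ - p)` is `r * (α e^{iθ} + β e^{-iθ})`, and `|β| < |α|` because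
`B` preserves orientation across the axis. Around a closed loop neither `r > 0` nor the linear
distortion contributes, which leaves the change of `iθ`. A general `B` covers both `axisProj` and
the map of `IsFrame.exists_axis`. -/
theorem logVar_eq_of_hasWindingNumber {γ : ℝ → E3} {x y : ℝ} {p q : E3} {n : ℤ}
    {B : E3 →ₗ[ℝ] ℂ} (hBd : B (p - q) = 0)
    (hB : ∀ u w, 0 < det3 u w (p - q) → 0 < planeDet (B u) (B w)) (hxy : x ≤ y)
    (hγ : ContinuousOn γ (Icc x y)) (hcl : γ x = γ y) (h : HasWindingNumber γ x y p q n) :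
    logVar (fun z => B (γ z - p)) x y = 2 * Real.pi * Complex.I * n := by
  obtain ⟨u, w, hdet, r, θ, ζ, hθ, hrep, hn⟩ := h
  have hpos := hB u w hdet
  set α : ℂ := (B u - B w * Complex.I) / 2 with hα
  set β : ℂ := (B u + B w * Complex.I) / 2 with hβ
  have hnorm : ‖α‖ ^ 2 - ‖β‖ ^ 2 = planeDet (B u) (B w) := by
    rw [← Complex.normSq_eq_norm_sq, ← Complex.normSq_eq_norm_sq, Complex.normSq_apply,
      Complex.normSq_apply, hα, hβ]
    simp [planeDet]
    ring
  have hlt : ‖β‖ < ‖α‖ := lt_of_pow_lt_pow_left₀ 2 (norm_nonneg _) (by linarith)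
  set e : ℝ → ℂ := fun z => Complex.exp (θ z * Complex.I) with he
  have hec : ContinuousOn e (Icc x y) := by
    refine Complex.continuous_exp.comp_continuousOn ?_
    exact (Complex.continuous_ofReal.comp_continuousOn hθ).mul continuousOn_const
  have he0 : ∀ z ∈ Icc x y, e z ≠ 0 := fun z _ => Complex.exp_ne_zero _
  have hecl : e x = e y := by
    have : (θ y : ℂ) * Complex.I = θ x * Complex.I + n * (2 * Real.pi * Complex.I) := by
      rw [show θ y = θ x + 2 * Real.pi * n by linarith]
      push_cast
      ring
    simp only [he, this]
    exact (Complex.exp_periodic.int_mul n _).symm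
  set m : ℝ → ℂ := fun z => α * e z + β * (starRingEnd ℂ) (e z) with hm
  have hmc : ContinuousOn m (Icc x y) :=
    (continuousOn_const.mul hec).add
      (continuousOn_const.mul (Complex.continuous_conj.comp_continuousOn hec))
  have hm0 : ∀ z ∈ Icc x y, m z ≠ 0 := fun z hz h0 => by
    have h1 : ‖α * e z‖ = ‖β * (starRingEnd ℂ) (e z)‖ := by
      rw [eq_neg_of_add_eq_zero_left h0, norm_neg]
    rw [norm_mul, norm_mul, Complex.norm_conj] at h1
    exact hlt.ne' (mul_right_cancel₀ (norm_ne_zero_iff.2 (he0 z hz)) h1)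
  have hBrep : ∀ z ∈ Icc x y, B (γ z - p) = r z * m z := fun z hz => by
    rw [(hrep z hz).2, show p + r z • (Real.cos (θ z) • u + Real.sin (θ z) • w) + ζ z • (p - q) - p
      = r z • (Real.cos (θ z) • u + Real.sin (θ z) • w) + ζ z • (p - q) by abel]
    simp only [map_add, map_smul, hBd, smul_zero, add_zero, Complex.real_smul, hm, he, hα, hβ]
    rw [← Complex.exp_conj]
    simp only [map_mul, Complex.conj_ofReal, Complex.conj_I]
    rw [Complex.exp_mul_I, show (θ z : ℂ) * -Complex.I = (-θ z : ℂ) * Complex.I by ring,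
      Complex.exp_mul_I, Complex.cos_neg, Complex.sin_neg]
    push_cast
    ring_nf
    simp
  have hBc : ContinuousOn (fun z => B (γ z - p)) (Icc x y) :=
    B.continuous_of_finiteDimensional.comp_continuousOn (hγ.sub continuousOn_const)
  -- `HasWindingNumber` asks for continuity of `θ` only; that of `r` is recovered as a quotient.
  have hrc : ContinuousOn (fun z => (r z : ℂ)) (Icc x y) :=
    (hBc.div hmc hm0).congr fun z hz => by
      rw [Pi.div_apply, hBrep z hz, mul_div_cancel_right₀ _ (hm0 z hz)]
  have hr0 : ∀ z ∈ Icc x y, (r z : ℂ) ≠ 0 := fun z hz =>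
    Complex.ofReal_ne_zero.2 (hrep z hz).1.ne'
  have hx := left_mem_Icc.2 hxy
  have hy := right_mem_Icc.2 hxy
  have hrcl : (r x : ℂ) = r y := by
    have h1 := hBrep x hx
    rw [hcl, hBrep y hy, show m x = m y by simp only [hm, hecl]] at h1
    exact (mul_right_cancel₀ (hm0 y hy) h1).symm
  have hel : IsLog (fun z => (θ z : ℂ) * Complex.I) e (Icc x y) :=
    ⟨(Complex.continuous_ofReal.comp_continuousOn hθ).mul continuousOn_const, fun _ _ => rfl⟩
  rw [logVar_congr hBrep, logVar_mul hxy hrc hr0 hmc hm0, logVar_linear hxy hec he0 hecl hlt,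
    logVar_of_slitPlane hxy hrc (fun z hz => Or.inl (by simpa using (hrep z hz).1)), hrcl,
    hel.logVar_eq hxy, show θ y = θ x + 2 * Real.pi * n by linarith]
  push_cast
  ring

/-- Given a logarithm `ℓ` of the projected loop, `θ` is its imaginary part, `r` the exponential of
its real part up to scale, and `ζ` comes from Cramer's rule. -/
theorem hasWindingNumber_of_logVar {γ : ℝ → E3} {x y : ℝ} {p q u w : E3} {n : ℤ}
    (hdet : 0 < det3 u w (p - q)) (hxy : x ≤ y) (hγ : ContinuousOn γ (Icc x y))
    (h0 : ∀ z ∈ Icc x y, axisProj u w (p - q) (γ z - p) ≠ 0)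
    (h : logVar (fun z => axisProj u w (p - q) (γ z - p)) x y = 2 * Real.pi * Complex.I * n) :
    HasWindingNumber γ x y p q n := by
  have hBc : ContinuousOn (fun z => axisProj u w (p - q) (γ z - p)) (Icc x y) :=
    (axisProj u w (p - q)).continuous_of_finiteDimensional.comp_continuousOn
      (hγ.sub continuousOn_const)
  obtain ⟨ℓ, hl⟩ := exists_isLog_Icc hBc h0
  rw [hl.logVar_eq hxy] at h
  set Δ := det3 u w (p - q) with hΔ
  refine ⟨u, w, hdet, fun z => Real.exp (ℓ z).re / Δ, fun z => (ℓ z).im,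
    fun z => det3 u w (γ z - p) / Δ, Complex.continuous_im.comp_continuousOn hl.continuousOn,
    fun z hz => ⟨by positivity, ?_⟩, ?_⟩
  · have h1 := hl.exp_eq z hz
    have hr : Real.exp (ℓ z).re * Real.cos (ℓ z).im = det3 (γ z - p) w (p - q) := by
      rw [← Complex.exp_re, h1]
      simp [axisProj_apply]
    have hi : Real.exp (ℓ z).re * Real.sin (ℓ z).im = det3 u (γ z - p) (p - q) := by
      rw [← Complex.exp_im, h1]
      simp [axisProj_apply]
    have h2 := det3_smul_eq u w (p - q) (γ z - p)
    rw [← hr, ← hi, ← hΔ] at h2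
    have h3 : γ z - p = Δ⁻¹ • (Δ • (γ z - p)) := by
      rw [smul_smul, inv_mul_cancel₀ hdet.ne', one_smul]
    rw [h2] at h3
    rw [add_assoc, ← sub_eq_iff_eq_add', h3]
    simp only [smul_add, smul_smul, div_eq_inv_mul, mul_assoc]
  · have := congrArg Complex.im h
    simpa using this

/-- Replaces the existential choice of `u, w` by any fixed positive pair. -/
theorem hasWindingNumber_iff {γ : ℝ → E3} {x y : ℝ} {p q u w : E3} {n : ℤ}
    (hdet : 0 < det3 u w (p - q)) (hxy : x ≤ y) (hγ : ContinuousOn γ (Icc x y)) (hcl : γ x = γ y)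
    (h0 : ∀ z ∈ Icc x y, axisProj u w (p - q) (γ z - p) ≠ 0) :
    HasWindingNumber γ x y p q n ↔
      logVar (fun z => axisProj u w (p - q) (γ z - p)) x y = 2 * Real.pi * Complex.I * n :=
  ⟨logVar_eq_of_hasWindingNumber (axisProj_axis _ _ _)
    (fun u' w' h => by rw [planeDet_axisProj]; positivity) hxy hγ hcl,
    hasWindingNumber_of_logVar hdet hxy hγ h0⟩

/-! ### Stereographic projection -/

/-- `e₁, e₂, N` is an orthonormal basis of negative orientation. -/
structure IsFrame (e₁ e₂ N : E3) : Prop where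
  parseval : ∀ P Q, dot3 e₁ P * dot3 e₁ Q + dot3 e₂ P * dot3 e₂ Q + dot3 N P * dot3 N Q = dot3 P Q
  -- With this orientation, stereographic projection from `N` preserves the orientation of the
  -- sphere by its outward normal.
  det : det3 e₁ e₂ N = -1

/-- The product of two determinants is the determinant of the scalar products. -/
theorem gram (P Q e N : E3) : det3 P e N * det3 Q e N =
    dot3 P Q * (dot3 e e * dot3 N N - dot3 e N ^ 2)
      - dot3 P e * (dot3 Q e * dot3 N N - dot3 e N * dot3 Q N)
      + dot3 P N * (dot3 Q e * dot3 e N - dot3 e e * dot3 Q N) := by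
  simp only [det3_eq, dot3]; ring

theorem exists_isFrame {N : E3} (hN : N ∈ S2) : ∃ e₁ e₂, IsFrame e₁ e₂ N := by
  rw [mem_S2_iff] at hN
  -- A horizontal unit vector orthogonal to `N`; it is arbitrary if `N` is vertical.
  obtain ⟨e, he, heN⟩ : ∃ e : E3, dot3 e e = 1 ∧ dot3 e N = 0 := by
    by_cases h : N 0 ^ 2 + N 1 ^ 2 = 0
    · have h0 : N 0 = 0 := by nlinarith [sq_nonneg (N 0), sq_nonneg (N 1)]
      exact ⟨!₂[1, 0, 0], by simp [dot3], by simp [dot3, h0]⟩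
    · have hpos : 0 < N 0 ^ 2 + N 1 ^ 2 := lt_of_le_of_ne (by positivity) (Ne.symm h)
      have hs := Real.sq_sqrt hpos.le
      set s := Real.sqrt (N 0 ^ 2 + N 1 ^ 2) with hsdef
      have hs0 : s ≠ 0 := (Real.sqrt_pos.2 hpos).ne'
      refine ⟨!₂[-N 1 / s, N 0 / s, 0], ?_, ?_⟩
      · simp [dot3]
        field_simp
        linarith
      · simp [dot3]
        field_simp
        ring
  -- This is the cross product `e × N`; the order of the factors produces the negative orientation.
  set f : E3 := !₂[e 1 * N 2 - e 2 * N 1, e 2 * N 0 - e 0 * N 2, e 0 * N 1 - e 1 * N 0] with hf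
  have hfd : ∀ P, dot3 f P = det3 P e N := fun P => by
    simp [dot3, hf, det3_eq]; ring
  refine ⟨e, f, fun P Q => ?_, ?_⟩
  · have := gram P Q e N
    rw [he, hN, heN] at this
    rw [hfd, hfd, this]
    simp only [dot3]
    ring
  · have h1 : det3 e f N = -dot3 f f := by simp [dot3, hf, det3_eq]; ring
    have h2 : dot3 f f = dot3 e e * dot3 N N - dot3 e N ^ 2 := by simp [dot3, hf]; ring
    rw [h1, h2, he, hN, heN]
    norm_num

theorem IsFrame.det3_eq {e₁ e₂ N : E3} (h : IsFrame e₁ e₂ N) (u v w : E3) : det3 u v w =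
    -(dot3 e₁ u * (dot3 e₂ v * dot3 N w - dot3 N v * dot3 e₂ w)
      - dot3 e₂ u * (dot3 e₁ v * dot3 N w - dot3 N v * dot3 e₁ w)
      + dot3 N u * (dot3 e₁ v * dot3 e₂ w - dot3 e₂ v * dot3 e₁ w)) := by
  have : det3 e₁ e₂ N * det3 u v w = dot3 e₁ u * (dot3 e₂ v * dot3 N w - dot3 N v * dot3 e₂ w)
      - dot3 e₂ u * (dot3 e₁ v * dot3 N w - dot3 N v * dot3 e₁ w)
      + dot3 N u * (dot3 e₁ v * dot3 e₂ w - dot3 e₂ v * dot3 e₁ w) := by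
    simp only [Knotoids.det3_eq, dot3]; ring
  rw [← this, h.det]
  ring

/-- The stereographic projection from `N` in the coordinates of a frame. -/
def stereo (e₁ e₂ N P : E3) : ℂ :=
  ⟨dot3 e₁ P / (1 - dot3 N P), dot3 e₂ P / (1 - dot3 N P)⟩

/-- The derivative of the stereographic projection at `P` in the direction `v`. -/
def stereoDeriv (e₁ e₂ N P v : E3) : ℂ :=
  ⟨(dot3 e₁ v * (1 - dot3 N P) + dot3 e₁ P * dot3 N v) / (1 - dot3 N P) ^ 2,
    (dot3 e₂ v * (1 - dot3 N P) + dot3 e₂ P * dot3 N v) / (1 - dot3 N P) ^ 2⟩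

/-- On the unit sphere `|P - N|² = 2 (1 - N·P)`. -/
theorem one_sub_dot3_pos {N P : E3} (hN : N ∈ S2) (hP : P ∈ S2) (h : P ≠ N) :
    0 < 1 - dot3 N P := by
  rw [mem_S2_iff] at hN hP
  have h1 : dot3 (P - N) (P - N) = 2 * (1 - dot3 N P) := by
    have : dot3 (P - N) (P - N) = dot3 P P + dot3 N N - 2 * dot3 N P := by
      simp [dot3]; ring
    rw [this, hN, hP]; ring
  have h2 : 0 ≤ dot3 (P - N) (P - N) := by rw [dot3_self]; positivity
  have h3 : dot3 (P - N) (P - N) ≠ 0 := fun h0 => h (dot3_sub_self_eq_zero.1 h0)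
  have := lt_of_le_of_ne h2 h3.symm
  linarith

section stereo

variable {e₁ e₂ N : E3}

/-- The inverse of the stereographic projection. -/
theorem IsFrame.coords (hf : IsFrame e₁ e₂ N) (hN : N ∈ S2) {P : E3} (hP : P ∈ S2) (h : P ≠ N) :
    ∃ a b : ℝ, stereo e₁ e₂ N P = ⟨a, b⟩ ∧ dot3 e₁ P = 2 * a / (1 + a ^ 2 + b ^ 2) ∧
      dot3 e₂ P = 2 * b / (1 + a ^ 2 + b ^ 2) ∧
      dot3 N P = 1 - 2 / (1 + a ^ 2 + b ^ 2) := by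
  have hpos := one_sub_dot3_pos hN hP h
  have hpar := hf.parseval P P
  rw [mem_S2_iff.1 hP] at hpar
  refine ⟨_, _, rfl, ?_⟩
  set x := dot3 e₁ P
  set y := dot3 e₂ P
  set z := dot3 N P
  have hs : 1 + (x / (1 - z)) ^ 2 + (y / (1 - z)) ^ 2 = 2 / (1 - z) := by
    field_simp
    linear_combination hpar
  rw [hs]
  refine ⟨?_, ?_, ?_⟩ <;> field_simp
  ring

theorem IsFrame.stereo_injOn (hf : IsFrame e₁ e₂ N) (hN : N ∈ S2) {P Q : E3} (hP : P ∈ S2)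
    (hQ : Q ∈ S2) (hPN : P ≠ N) (hQN : Q ≠ N) (h : stereo e₁ e₂ N P = stereo e₁ e₂ N Q) :
    P = Q := by
  obtain ⟨a, b, h1, h2, h3, h4⟩ := hf.coords hN hP hPN
  obtain ⟨a', b', h1', h2', h3', h4'⟩ := hf.coords hN hQ hQN
  obtain ⟨rfl, rfl⟩ : a = a' ∧ b = b' := by
    have := h1.symm.trans (h.trans h1')
    exact ⟨congrArg Complex.re this, congrArg Complex.im this⟩
  have hsub : ∀ u : E3, dot3 u (P - Q) = dot3 u P - dot3 u Q := fun u => by simp [dot3]; ring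
  rw [← dot3_sub_self_eq_zero, ← hf.parseval, hsub, hsub, hsub, h2, h3, h4, h2', h3', h4']
  ring

theorem continuousOn_stereo (hN : N ∈ S2) : ContinuousOn (stereo e₁ e₂ N) (S2 \ {N}) := by
  have h0 : ∀ P ∈ S2 \ {N}, 1 - dot3 N P ≠ 0 := fun P hP =>
    (one_sub_dot3_pos hN hP.1 (by simpa using hP.2)).ne'
  have : stereo e₁ e₂ N = fun P => ((dot3 e₁ P / (1 - dot3 N P) : ℝ) : ℂ)
      + (dot3 e₂ P / (1 - dot3 N P) : ℝ) * Complex.I := by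
    ext P
    exact (Complex.re_add_im _).symm
  rw [this]
  refine (Complex.continuous_ofReal.comp_continuousOn ?_).add
    ((Complex.continuous_ofReal.comp_continuousOn ?_).mul continuousOn_const)
  · exact (continuous_dot3 _).continuousOn.div (by fun_prop) h0
  · exact (continuous_dot3 _).continuousOn.div (by fun_prop) h0

theorem hasDerivAt_dot3 {γ : ℝ → E3} {v : E3} {s : ℝ} (u : E3) (h : HasDerivAt γ v s) :
    HasDerivAt (fun s => dot3 u (γ s)) (dot3 u v) s := by
  have hi : ∀ i, HasDerivAt (fun s => γ s i) (v i) s := fun i =>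
    (EuclideanSpace.proj i : E3 →L[ℝ] ℝ).hasFDerivAt.comp_hasDerivAt s h
  unfold dot3
  exact (((hi 0).const_mul _).add ((hi 1).const_mul _)).add ((hi 2).const_mul _)

theorem hasDerivAt_stereo {γ : ℝ → E3} {v : E3} {s : ℝ} (h : HasDerivAt γ v s)
    (h0 : 1 - dot3 N (γ s) ≠ 0) :
    HasDerivAt (fun s => stereo e₁ e₂ N (γ s)) (stereoDeriv e₁ e₂ N (γ s) v) s := by
  have hd : HasDerivAt (fun s => 1 - dot3 N (γ s)) (-dot3 N v) s :=
    (hasDerivAt_dot3 N h).const_sub 1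
  have h1 := ((hasDerivAt_dot3 e₁ h).div hd h0).ofReal_comp
  have h2 := ((hasDerivAt_dot3 e₂ h).div hd h0).ofReal_comp
  convert! h1.add (h2.mul_const Complex.I) using 1
  · ext s
    exact (Complex.re_add_im _).symm
  · rw [← Complex.re_add_im (stereoDeriv e₁ e₂ N (γ s) v)]
    simp [stereoDeriv]

/-- The stereographic projection is conformal and preserves the orientation. -/
theorem IsFrame.planeDet_stereoDeriv (hf : IsFrame e₁ e₂ N) {P v w : E3} (hP : P ∈ S2)
    (h0 : 1 - dot3 N P ≠ 0) (hv : dot3 P v = 0) (hw : dot3 P w = 0) :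
    planeDet (stereoDeriv e₁ e₂ N P v) (stereoDeriv e₁ e₂ N P w) =
      det3 P v w / (1 - dot3 N P) ^ 2 := by
  have hpar := hf.parseval P P
  rw [mem_S2_iff.1 hP] at hpar
  rw [← hf.parseval] at hv hw
  rw [hf.det3_eq]
  simp only [planeDet, stereoDeriv]
  set x := dot3 e₁ P
  set y := dot3 e₂ P
  set z := dot3 N P
  set v1 := dot3 e₁ v
  set v2 := dot3 e₂ v
  set v3 := dot3 N v
  set w1 := dot3 e₁ w
  set w2 := dot3 e₂ w
  set w3 := dot3 N w
  field_simp
  -- For tangent vectors `v × w` is the multiple of `P` by the triple product; this is its component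
  -- along `N`.
  have key : v1 * w2 - v2 * w1 =
      (x * (v2 * w3 - v3 * w2) - y * (v1 * w3 - v3 * w1) + z * (v1 * w2 - v2 * w1)) * z := by
    linear_combination (-(v1 * w2 - v2 * w1)) * hpar + (x * w2 - y * w1) * hv - (x * v2 - y * v1) * hw
  linear_combination (1 - z) * key

/-- The quotient of two coordinate differences is, up to a positive factor, the projection along
the axis through the two points. -/
theorem IsFrame.exists_axis (hf : IsFrame e₁ e₂ N) (hN : N ∈ S2) {p q : E3} (hp : p ∈ S2)
    (hq : q ∈ S2) (hpN : p ≠ N) (hqN : q ≠ N) :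
    ∃ B : E3 →ₗ[ℝ] ℂ, B (p - q) = 0 ∧
      (∀ u w, 0 < det3 u w (p - q) → 0 < planeDet (B u) (B w)) ∧
      ∀ P ∈ S2, P ≠ N → B (P - p) = ((1 - dot3 N P : ℝ) : ℂ) *
        ((stereo e₁ e₂ N P - stereo e₁ e₂ N p) *
          (starRingEnd ℂ) (stereo e₁ e₂ N P - stereo e₁ e₂ N q)) := by
  obtain ⟨a, b, hz, hp1, hp2, hp3⟩ := hf.coords hN hp hpN
  obtain ⟨a', b', hz', hq1, hq2, hq3⟩ := hf.coords hN hq hqN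
  have hadd : ∀ u X Y : E3, dot3 u (X + Y) = dot3 u X + dot3 u Y := fun u X Y => by
    simp [dot3]; ring
  have hsub : ∀ u X Y : E3, dot3 u (X - Y) = dot3 u X - dot3 u Y := fun u X Y => by
    simp [dot3]; ring
  have hsmul : ∀ (u : E3) (c : ℝ) (X : E3), dot3 u (c • X) = c * dot3 u X := fun u c X => by
    simp [dot3]; ring
  -- Multiply out `(z - z_p) * conj (z - z_q)` times `1 - N·P`. Since `(1 - N·P)|z|² = 1 + N·P` and
  -- `(1 - N·P) z = e₁·P + i e₂·P`, the result is affine in `P` and vanishes at `p` and `q`; `B` is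
  -- its linear part.
  let B : E3 →ₗ[ℝ] ℂ :=
    { toFun := fun X => ⟨dot3 N X * (1 - (a * a' + b * b')) - dot3 e₁ X * (a + a')
          - dot3 e₂ X * (b + b'),
        dot3 N X * (a * b' - b * a') - dot3 e₁ X * (b - b') + dot3 e₂ X * (a - a')⟩
      map_add' := fun X Y => by
        simp only [hadd]
        apply Complex.ext <;> simp <;> ring
      map_smul' := fun c X => by
        simp only [hsmul]
        apply Complex.ext <;> simp <;> ring }
  have hB : ∀ X, B X = ⟨dot3 N X * (1 - (a * a' + b * b')) - dot3 e₁ X * (a + a')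
          - dot3 e₂ X * (b + b'),
        dot3 N X * (a * b' - b * a') - dot3 e₁ X * (b - b') + dot3 e₂ X * (a - a')⟩ := fun _ => rfl
  have hn : 1 + a ^ 2 + b ^ 2 ≠ 0 := by positivity
  have hn' : 1 + a' ^ 2 + b' ^ 2 ≠ 0 := by positivity
  refine ⟨B, ?_, fun u w h => ?_, fun P hP hPN => ?_⟩
  · rw [hB]
    simp only [hsub, hp1, hp2, hp3, hq1, hq2, hq3]
    apply Complex.ext <;> simp <;> field_simp <;> ring
  · have key : planeDet (B u) (B w) =
        (1 + a ^ 2 + b ^ 2) * (1 + a' ^ 2 + b' ^ 2) / 2 * det3 u w (p - q) := by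
      rw [hf.det3_eq, hB, hB]
      simp only [hsub, hp1, hp2, hp3, hq1, hq2, hq3, planeDet]
      field_simp
      ring
    rw [key]
    positivity
  · obtain ⟨c, d, hz'', hP1, hP2, hP3⟩ := hf.coords hN hP hPN
    have hn'' : 1 + c ^ 2 + d ^ 2 ≠ 0 := by positivity
    rw [hB, hz, hz', hz'']
    simp only [hsub, hp1, hp2, hp3, hP1, hP2, hP3]
    apply Complex.ext
    · rw [Complex.re_ofReal_mul]
      simp
      field_simp
      ring
    · rw [Complex.im_ofReal_mul]
      simp
      field_simp
      ring

end stereo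

/-! ### Basic facts on diagrams -/

theorem IsDouble.symm {γ : ℝ → E3} {x y : ℝ} (h : IsDouble γ x y) : IsDouble γ y x :=
  ⟨h.2.1, h.1, h.2.2.1.symm, h.2.2.2.symm⟩

theorem exists_det3_pos {d : E3} (hd : d ≠ 0) : ∃ u w, 0 < det3 u w d := by
  have hn : 0 < ‖d‖ := norm_pos_iff.2 hd
  have hN : ‖d‖⁻¹ • d ∈ S2 := by
    rw [mem_sphere_zero_iff_norm, norm_smul, norm_inv, norm_norm, inv_mul_cancel₀ hn.ne']
  obtain ⟨e₁, e₂, h⟩ := exists_isFrame hN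
  refine ⟨e₂, e₁, ?_⟩
  have h1 : det3 e₁ e₂ (‖d‖⁻¹ • d) = -(‖d‖⁻¹ * det3 e₂ e₁ d) := by
    simp only [det3_eq, PiLp.smul_apply, smul_eq_mul]; ring
  have h2 := h.det
  rw [h1, neg_inj] at h2
  by_contra h3
  have : ‖d‖⁻¹ * det3 e₂ e₁ d ≤ 0 := mul_nonpos_of_nonneg_of_nonpos (by positivity) (not_lt.1 h3)
  linarith

/-- A tangent vector of a curve on the sphere. -/
theorem dot3_deriv_eq_zero {γ : ℝ → E3} {v : E3} {s : ℝ} (hγ : HasDerivAt γ v s)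
    (h : ∀ᶠ z in 𝓝 s, γ z ∈ S2) : dot3 (γ s) v = 0 := by
  have hi : ∀ i, HasDerivAt (fun s => γ s i) (v i) s := fun i =>
    (EuclideanSpace.proj i : E3 →L[ℝ] ℝ).hasFDerivAt.comp_hasDerivAt s hγ
  have h1 := ((((hi 0).mul (hi 0)).add ((hi 1).mul (hi 1))).add ((hi 2).mul (hi 2)))
  have h2 : HasDerivAt (fun _ : ℝ => (1 : ℝ)) 0 s := hasDerivAt_const _ _
  have h3 := (h1.congr_of_eventuallyEq (f₁ := fun _ => (1 : ℝ)) (by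
    filter_upwards [h] with z hz
    exact (mem_S2_iff.1 hz).symm)).unique h2
  unfold dot3
  linarith

namespace KnotoidDiagram

variable (K : KnotoidDiagram)

theorem hasDerivAt (x : ℝ) : HasDerivAt K.toFun (deriv K.toFun x) x :=
  ((K.smooth.differentiable (by simp)) x).hasDerivAt

theorem continuous : Continuous K.toFun := K.smooth.continuous

theorem ne_tail {x : ℝ} (hx : x ∈ Ioo (0 : ℝ) 1) : K.toFun x ≠ K.tail := fun h =>
  lt_irrefl _ (K.double_interior 0 x
    ⟨by simp, Ioo_subset_Icc_self hx, hx.1.ne, h.symm⟩).1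

theorem ne_head {x : ℝ} (hx : x ∈ Ioo (0 : ℝ) 1) : K.toFun x ≠ K.head := fun h =>
  lt_irrefl _ (K.double_interior 1 x
    ⟨by simp, Ioo_subset_Icc_self hx, hx.2.ne', h.symm⟩).2

theorem tail_ne_head : K.tail ≠ K.head := fun h =>
  lt_irrefl _ (K.double_interior 0 1 ⟨by simp, by simp, by simp, h⟩).1

theorem tail_mem : K.tail ∈ S2 := K.mem_sphere 0 (by simp)

theorem head_mem : K.head ∈ S2 := K.mem_sphere 1 (by simp)

variable {K}

theorem IsDouble.Icc_subset {x y : ℝ} (h : IsDouble K.toFun x y) : Icc x y ⊆ Ioo 0 1 :=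
  fun _ hz => ⟨(K.double_interior x y h).1.trans_le hz.1,
    hz.2.trans_lt (K.double_interior y x h.symm).2⟩

/-- The interior of the diagram in the plane along the axis through the endpoints. -/
def axisCurve (K : KnotoidDiagram) (u w : E3) (x : ℝ) : ℂ :=
  axisProj u w (K.tail - K.head) (K.toFun x - K.tail)

theorem continuous_axisCurve (u w : E3) : Continuous (K.axisCurve u w) :=
  (axisProj u w (K.tail - K.head)).continuous_of_finiteDimensional.comp
    (K.continuous.sub continuous_const)

theorem axisCurve_ne_zero {u w : E3} (h : 0 < det3 u w (K.tail - K.head)) {x : ℝ}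
    (hx : x ∈ Ioo (0 : ℝ) 1) : K.axisCurve u w x ≠ 0 :=
  axisProj_ne_zero h K.tail_mem K.head_mem (K.mem_sphere x (Ioo_subset_Icc_self hx))
    (K.ne_tail hx) (K.ne_head hx)

theorem exists_isLog_axisCurve {u w : E3} (h : 0 < det3 u w (K.tail - K.head)) :
    ∃ ℓ, IsLog ℓ (K.axisCurve u w) (Ioo 0 1) :=
  exists_isLog (convex_Ioo 0 1) (continuous_axisCurve u w).continuousOn
    fun _ hx => axisCurve_ne_zero h hx

/-- A single angular coordinate along the interior of the diagram yields the indices of all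
crossings as differences of its values. -/
theorem hasIndex_iff {u w : E3} (h : 0 < det3 u w (K.tail - K.head)) {ℓ : ℝ → ℂ}
    (hl : IsLog ℓ (K.axisCurve u w) (Ioo 0 1)) {x y : ℝ} (hd : IsDouble K.toFun x y) (hxy : x < y)
    {n : ℤ} : K.HasIndex (x, y) n ↔ ℓ y - ℓ x = 2 * Real.pi * Complex.I * n := by
  have hsub := IsDouble.Icc_subset hd
  rw [← (hl.mono hsub).logVar_eq hxy.le]
  exact hasWindingNumber_iff h hxy.le K.continuous.continuousOn hd.2.2.2
    fun z hz => axisCurve_ne_zero h (hsub hz)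

/-! ### The writhes as sums over pairs of an over- and an under-parameter -/

variable (K)

/-- The crossings of index `n`, each given by the parameters of its over-strand and of its
under-strand. -/
def overPairs (n : ℤ) : Set (ℝ × ℝ) :=
  {c | IsDouble K.toFun c.1 c.2 ∧ K.isOver c.1 c.2 ∧ K.HasIndex (min c.1 c.2, max c.1 c.2) n}

/-- The orientation of the pair of tangents at a double point. -/
def pairSign (c : ℝ × ℝ) : ℤ :=
  SignType.sign (det3 (K.toFun c.1) (deriv K.toFun c.1) (deriv K.toFun c.2))

theorem finite_overPairs (n : ℤ) : (K.overPairs n).Finite :=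
  K.finite_double.subset fun _ hc => hc.1

theorem sign_eq_ite {r : ℝ} (hr : r ≠ 0) :
    ((SignType.sign r : SignType) : ℤ) = if 0 < r then 1 else -1 := by
  rcases lt_or_gt_of_ne hr with h | h
  · rw [sign_neg h, if_neg (not_lt.2 h.le)]; rfl
  · rw [sign_pos h, if_pos h]; rfl

theorem crossingSign_eq {c : ℝ × ℝ} (hd : IsDouble K.toFun c.1 c.2) (ho : K.isOver c.1 c.2) :
    K.crossingSign (min c.1 c.2, max c.1 c.2) = K.pairSign c := by
  obtain ⟨x, y⟩ := c
  simp only at hd ho ⊢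
  rw [pairSign, sign_eq_ite (K.transverse x y hd)]
  rcases lt_or_gt_of_ne hd.2.2.1 with h | h
  · rw [min_eq_left h.le, max_eq_right h.le, crossingSign, if_pos ho]
  · rw [min_eq_right h.le, max_eq_left h.le, crossingSign, if_neg ((K.isOver_iff x y hd).1 ho)]
    simp only [hd.2.2.2]

/-- Exactly one of the two orders of the parameters of a crossing puts the over-strand first, and in
that order the sign is a determinant without case distinction. -/
theorem writhe_eq (n : ℤ) :
    K.writhe n = 1 / 2 * ∑ᶠ c ∈ K.overPairs n, (K.pairSign c : ℚ) := by
  rw [writhe]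
  congr 1
  symm
  refine finsum_mem_eq_of_bijOn (fun c => (min c.1 c.2, max c.1 c.2)) ⟨?_, ?_, ?_⟩ ?_
  · rintro ⟨x, y⟩ ⟨hd, -, hi⟩
    refine ⟨?_, hi⟩
    rcases lt_or_gt_of_ne hd.2.2.1 with h | h
    · simp only [min_eq_left h.le, max_eq_right h.le]
      exact ⟨hd, h⟩
    · simp only [min_eq_right h.le, max_eq_left h.le]
      exact ⟨hd.symm, h⟩
  · rintro ⟨x, y⟩ ⟨hd, ho, -⟩ ⟨x', y'⟩ ⟨hd', ho', -⟩ h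
    simp only [Prod.mk.injEq] at h hd hd' ho ho'
    obtain ⟨h1, h2⟩ := h
    rcases lt_or_gt_of_ne hd.2.2.1 with h | h <;> rcases lt_or_gt_of_ne hd'.2.2.1 with h' | h'
    · rw [min_eq_left h.le, min_eq_left h'.le] at h1
      rw [max_eq_right h.le, max_eq_right h'.le] at h2
      rw [h1, h2]
    · rw [min_eq_left h.le, min_eq_right h'.le] at h1
      rw [max_eq_right h.le, max_eq_left h'.le] at h2
      subst h1 h2
      exact absurd ho' ((K.isOver_iff _ _ hd).1 ho)
    · rw [min_eq_right h.le, min_eq_left h'.le] at h1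
      rw [max_eq_left h.le, max_eq_right h'.le] at h2
      subst h1 h2
      exact absurd ho' ((K.isOver_iff _ _ hd).1 ho)
    · rw [min_eq_right h.le, min_eq_right h'.le] at h1
      rw [max_eq_left h.le, max_eq_left h'.le] at h2
      rw [h1, h2]
  · rintro ⟨x, y⟩ ⟨⟨hd, hlt⟩, hi⟩
    simp only at hd hlt
    by_cases ho : K.isOver x y
    · refine ⟨(x, y), ⟨hd, ho, ?_⟩, ?_⟩ <;>
      simp only [min_eq_left hlt.le, max_eq_right hlt.le]
      exact hi
    · refine ⟨(y, x), ⟨hd.symm, (K.isOver_iff _ _ hd.symm).2 ho, ?_⟩, ?_⟩ <;>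
      simp only [min_eq_right hlt.le, max_eq_left hlt.le]
      exact hi
  · rintro c ⟨hd, ho, -⟩
    rw [K.crossingSign_eq hd ho]

/-! ### The degree of the index polynomial -/

theorem indexPolynomial_congr {K' : KnotoidDiagram} (h : ∀ n ≠ 0, K.writhe n = K'.writhe n) :
    K.indexPolynomial = K'.indexPolynomial := by
  unfold indexPolynomial
  exact finsum_congr fun n => finsum_congr fun hn => by rw [h n hn]

/-- The term `tⁿ - 1` has exponents `n` and `0`, and `0` always lies in `[-b, a]`. Induction over
`finsum` requires no finiteness of the set of nonzero writhes. -/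
theorem support_indexPolynomial {a b : ℕ} (h : ∀ n, K.writhe n ≠ 0 → -(b : ℤ) ≤ n ∧ n ≤ a) :
    ∀ m ∈ K.indexPolynomial.coeff.support, -(b : ℤ) ≤ m ∧ m ≤ a := by
  unfold indexPolynomial
  refine finsum_induction (p := fun q : ℚ[T;T⁻¹] => ∀ m ∈ q.coeff.support, -(b : ℤ) ≤ m ∧ m ≤ a)
    (by simp) (fun p q hp hq m hm => ?_) fun n => ?_
  · rcases Finset.mem_union.1 (Finsupp.support_add hm) with h | h
    · exact hp m h
    · exact hq m h
  · refine finsum_induction (p := fun q : ℚ[T;T⁻¹] => ∀ m ∈ q.coeff.support, -(b : ℤ) ≤ m ∧ m ≤ a)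
      (by simp) (fun p q hp hq m hm => ?_) fun hn => ?_
    · rcases Finset.mem_union.1 (Finsupp.support_add hm) with h | h
      · exact hp m h
      · exact hq m h
    · by_cases hw : K.writhe n = 0
      · simp [hw]
      · intro m hm
        have hq : LaurentPolynomial.C (K.writhe n) * (LaurentPolynomial.T n - 1) =
            LaurentPolynomial.C (K.writhe n) * LaurentPolynomial.T n
              + LaurentPolynomial.C (-K.writhe n) * LaurentPolynomial.T 0 := by
          rw [LaurentPolynomial.T_zero, map_neg]
          ring
        rw [hq] at hm
        rcases Finset.mem_union.1 (Finsupp.support_add hm) with h' | h'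
        · rw [Finset.mem_singleton.1 (LaurentPolynomial.support_C_mul_T _ _ h')]
          exact h n hw
        · rw [Finset.mem_singleton.1 (LaurentPolynomial.support_C_mul_T _ _ h')]
          constructor <;> omega

theorem degPos_degNeg_le {a b : ℕ} (h : ∀ n, K.writhe n ≠ 0 → -(b : ℤ) ≤ n ∧ n ≤ a) :
    degPos K.indexPolynomial ≤ a ∧ degNeg K.indexPolynomial ≤ b := by
  have := K.support_indexPolynomial h
  constructor <;> refine Finset.sup_le fun m hm => ?_ <;> have := this m hm <;> omega

theorem exists_crossing {n : ℤ} (h : K.writhe n ≠ 0) : ∃ c ∈ K.crossings, K.HasIndex c n := by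
  by_contra! h0
  apply h
  rw [writhe, show {c | c ∈ K.crossings ∧ K.HasIndex c n} = ∅ from
    eq_empty_of_forall_notMem fun c hc => h0 c hc.1 hc.2]
  simp

end KnotoidDiagram

/-! ### Signed intersections of curves on the sphere -/

theorem sign_cast_neg (r : ℝ) : ((SignType.sign (-r) : SignType) : ℤ) = -(SignType.sign r : ℤ) := by
  rw [Left.sign_neg]
  cases SignType.sign r <;> rfl

/-- The signed number of intersections of two curves on the sphere, read off from the boundary
values of the difference of their stereographic projections. -/
theorem boundaryVar_stereo_sub {e₁ e₂ N : E3} (hf : IsFrame e₁ e₂ N) (hN : N ∈ S2) {α β : ℝ → E3}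
    {a b c d : ℝ} (hab : a < b) (hcd : c < d) (hα : Differentiable ℝ α) (hβ : Differentiable ℝ β)
    (hαS : ∀ s ∈ Icc a b, α s ∈ S2 \ {N}) (hβS : ∀ t ∈ Icc c d, β t ∈ S2 \ {N})
    (Z : Finset (ℝ × ℝ)) (hin : ∀ z ∈ Z, z ∈ Ioo a b ×ˢ Ioo c d)
    (h0 : ∀ z ∈ Icc a b ×ˢ Icc c d, α z.1 = β z.2 ↔ z ∈ Z)
    (hdet : ∀ z ∈ Z, det3 (α z.1) (deriv α z.1) (deriv β z.2) ≠ 0) :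
    boundaryVar (fun z => stereo e₁ e₂ N (α z.1) - stereo e₁ e₂ N (β z.2)) a b c d =
      2 * Real.pi * Complex.I *
        ((-∑ z ∈ Z, (SignType.sign (det3 (α z.1) (deriv α z.1) (deriv β z.2)) : ℤ) : ℤ) : ℂ) := by
  have hpos : ∀ {P : E3}, P ∈ S2 \ {N} → 0 < 1 - dot3 N P := fun hP =>
    one_sub_dot3_pos hN hP.1 (by simpa using hP.2)
  set v : ℝ × ℝ → ℂ := fun z => stereoDeriv e₁ e₂ N (α z.1) (deriv α z.1) with hv
  set w : ℝ × ℝ → ℂ := fun z => -stereoDeriv e₁ e₂ N (β z.2) (deriv β z.2) with hw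
  have hIcc : ∀ z ∈ Z, z.1 ∈ Icc a b ∧ z.2 ∈ Icc c d := fun z hz =>
    ⟨Ioo_subset_Icc_self (hin z hz).1, Ioo_subset_Icc_self (hin z hz).2⟩
  have hplane : ∀ z ∈ Z, planeDet (v z) (w z) =
      -(det3 (α z.1) (deriv α z.1) (deriv β z.2) / (1 - dot3 N (α z.1)) ^ 2) := by
    intro z hz
    have hαz := hαS z.1 (hIcc z hz).1
    have heq : α z.1 = β z.2 := (h0 z (hIcc z hz)).2 hz
    have ht1 : dot3 (α z.1) (deriv α z.1) = 0 :=
      dot3_deriv_eq_zero (hα z.1).hasDerivAt <| by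
        filter_upwards [isOpen_Ioo.mem_nhds (hin z hz).1] with s hs
        exact (hαS s (Ioo_subset_Icc_self hs)).1
    have ht2 : dot3 (α z.1) (deriv β z.2) = 0 := by
      rw [heq]
      refine dot3_deriv_eq_zero (hβ z.2).hasDerivAt ?_
      filter_upwards [isOpen_Ioo.mem_nhds (hin z hz).2] with s hs
      exact (hβS s (Ioo_subset_Icc_self hs)).1
    rw [← hf.planeDet_stereoDeriv hαz.1 (hpos hαz).ne' ht1 ht2]
    simp only [hv, hw, ← heq, planeDet, Complex.neg_re, Complex.neg_im]
    ring
  have hsign : ∀ z ∈ Z, (SignType.sign (planeDet (v z) (w z)) : ℤ) =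
      -(SignType.sign (det3 (α z.1) (deriv α z.1) (deriv β z.2)) : ℤ) := fun z hz => by
    have := hpos (hαS z.1 (hIcc z hz).1)
    rw [hplane z hz, sign_cast_neg, div_eq_mul_inv, sign_mul,
      sign_pos (inv_pos.2 (pow_pos this 2)), mul_one]
  rw [boundaryVar_eq_sum hab hcd v w Z ?_ hin ?_ ?_ ?_, Finset.sum_congr rfl hsign,
    Finset.sum_neg_distrib]
  · refine ContinuousOn.sub ?_ ?_
    · exact (continuousOn_stereo hN).comp (hα.continuous.comp continuous_fst).continuousOn
        fun z hz => hαS _ hz.1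
    · exact (continuousOn_stereo hN).comp (hβ.continuous.comp continuous_snd).continuousOn
        fun z hz => hβS _ hz.2
  · intro z hz
    rw [sub_eq_zero, ← h0 z hz]
    refine ⟨fun h => ?_, fun h => by rw [h]⟩
    have h1 := hαS _ hz.1
    have h2 := hβS _ hz.2
    exact hf.stereo_injOn hN h1.1 h2.1 (by simpa using h1.2) (by simpa using h2.2) h
  · intro z hz
    rw [hplane z hz]
    exact neg_ne_zero.2 (div_ne_zero (hdet z hz)
      (pow_ne_zero 2 (hpos (hαS z.1 (hIcc z hz).1)).ne'))
  · intro z hz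
    have d1 := (hasDerivAt_stereo (e₁ := e₁) (e₂ := e₂) (hα z.1).hasDerivAt
      (hpos (hαS z.1 (hIcc z hz).1)).ne').hasFDerivAt.comp z hasFDerivAt_fst
    have d2 := (hasDerivAt_stereo (e₁ := e₁) (e₂ := e₂) (hβ z.2).hasDerivAt
      (hpos (hβS z.2 (hIcc z hz).2)).ne').hasFDerivAt.comp z hasFDerivAt_snd
    refine ⟨_, d1.sub d2, fun u => ?_⟩
    simp [planeLinear, hv, hw, sub_eq_add_neg]

/-- Two smooth curves do not cover the sphere. -/
theorem exists_notMem_curves {α β : ℝ → E3} (hα : ContDiff ℝ ∞ α) (hβ : ContDiff ℝ ∞ β) :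
    ∃ N ∈ S2, ∀ x, α x ≠ N ∧ β x ≠ N := by
  -- The cone over a smooth curve is a smooth image of the plane, hence of Hausdorff dimension at
  -- most 2. A vector off both cones, normalized, is off both curves.
  have hdim : ∀ γ : ℝ → E3, ContDiff ℝ ∞ γ →
      dimH (range fun z : ℝ × ℝ => z.1 • γ z.2) ≤ 2 := fun γ hγ => by
    have h1 : ContDiff ℝ 1 fun z : ℝ × ℝ => z.1 • γ z.2 :=
      contDiff_fst.smul ((hγ.of_le (by simp)).comp contDiff_snd)
    simpa using h1.dimH_range_le
  have hd : Dense ((range fun z : ℝ × ℝ => z.1 • α z.2) ∪ range fun z : ℝ × ℝ => z.1 • β z.2)ᶜ := by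
    refine dense_compl_of_dimH_lt_finrank ?_
    rw [dimH_union]
    refine (max_le (hdim α hα) (hdim β hβ)).trans_lt ?_
    simp
    norm_num
  obtain ⟨v, hv⟩ := hd.nonempty
  simp only [mem_compl_iff, mem_union, mem_range, not_or, not_exists] at hv
  have hv0 : v ≠ 0 := fun h => hv.1 (0, 0) (by simp [h])
  have hn : ‖v‖ ≠ 0 := norm_ne_zero_iff.2 hv0
  refine ⟨‖v‖⁻¹ • v, ?_, fun x => ⟨fun h => hv.1 (‖v‖, x) ?_, fun h => hv.2 (‖v‖, x) ?_⟩⟩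
  · rw [mem_sphere_zero_iff_norm, norm_smul, norm_inv, norm_norm, inv_mul_cancel₀ hn]
  · simp only [h, smul_smul, mul_inv_cancel₀ hn, one_smul]
  · simp only [h, smul_smul, mul_inv_cancel₀ hn, one_smul]

/-- Around a closed loop the variation is in `2πiℤ`, hence purely imaginary. -/
theorem conj_logVar_eq_neg {g : ℝ → ℂ} {x y : ℝ} (hxy : x ≤ y) (hg : ContinuousOn g (Icc x y))
    (h0 : ∀ z ∈ Icc x y, g z ≠ 0) (hcl : g x = g y) :
    (starRingEnd ℂ) (logVar g x y) = -logVar g x y := by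
  have h1 := exp_logVar hxy hg h0
  rw [hcl, div_self (h0 y (right_mem_Icc.2 hxy)), Complex.exp_eq_one_iff] at h1
  obtain ⟨n, hn⟩ := h1
  rw [hn]
  simp [map_ofNat]

/-- The winding number of a loop around two points of the sphere in a stereographic projection. -/
theorem logVar_stereo_of_hasWindingNumber {e₁ e₂ N : E3} (hf : IsFrame e₁ e₂ N) (hN : N ∈ S2)
    {γ : ℝ → E3} {x y : ℝ} {p q : E3} {n : ℤ} (hxy : x ≤ y) (hγ : ContinuousOn γ (Icc x y))
    (hcl : γ x = γ y) (hγS : ∀ z ∈ Icc x y, γ z ∈ S2 \ {N}) (hp : p ∈ S2 \ {N})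
    (hq : q ∈ S2 \ {N}) (hγp : ∀ z ∈ Icc x y, γ z ≠ p) (hγq : ∀ z ∈ Icc x y, γ z ≠ q)
    (h : HasWindingNumber γ x y p q n) :
    logVar (fun z => stereo e₁ e₂ N (γ z) - stereo e₁ e₂ N p) x y
      - logVar (fun z => stereo e₁ e₂ N (γ z) - stereo e₁ e₂ N q) x y =
      2 * Real.pi * Complex.I * n := by
  obtain ⟨B, hBd, hB, hBz⟩ := hf.exists_axis hN hp.1 hq.1 (by simpa using hp.2) (by simpa using hq.2)
  have hS : ContinuousOn (fun z => stereo e₁ e₂ N (γ z)) (Icc x y) :=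
    (continuousOn_stereo hN).comp hγ hγS
  have hne : ∀ {r : E3}, r ∈ S2 \ {N} → (∀ z ∈ Icc x y, γ z ≠ r) →
      ∀ z ∈ Icc x y, stereo e₁ e₂ N (γ z) - stereo e₁ e₂ N r ≠ 0 := fun hr hγr z hz h =>
    hγr z hz (hf.stereo_injOn hN (hγS z hz).1 hr.1 (by simpa using (hγS z hz).2)
      (by simpa using hr.2) (sub_eq_zero.1 h))
  have hpos : ∀ z ∈ Icc x y, 0 < 1 - dot3 N (γ z) := fun z hz =>
    one_sub_dot3_pos hN (hγS z hz).1 (by simpa using (hγS z hz).2)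
  have h1c : ContinuousOn (fun z => ((1 - dot3 N (γ z) : ℝ) : ℂ)) (Icc x y) :=
    Complex.continuous_ofReal.comp_continuousOn
      (continuousOn_const.sub ((continuous_dot3 N).comp_continuousOn hγ))
  have hpc : ContinuousOn (fun z => stereo e₁ e₂ N (γ z) - stereo e₁ e₂ N p) (Icc x y) :=
    hS.sub continuousOn_const
  have hqc : ContinuousOn (fun z => stereo e₁ e₂ N (γ z) - stereo e₁ e₂ N q) (Icc x y) :=
    hS.sub continuousOn_const
  have hqc' : ContinuousOn (fun z => (starRingEnd ℂ) (stereo e₁ e₂ N (γ z) - stereo e₁ e₂ N q))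
      (Icc x y) := Complex.continuous_conj.comp_continuousOn hqc
  have hq0' : ∀ z ∈ Icc x y, (starRingEnd ℂ) (stereo e₁ e₂ N (γ z) - stereo e₁ e₂ N q) ≠ 0 :=
    fun z hz => (map_ne_zero _).2 (hne hq hγq z hz)
  -- Take variations in the factorization of `IsFrame.exists_axis`: the positive factor contributes
  -- zero, and the conjugated factor changes the sign of the winding around `q`.
  rw [← logVar_eq_of_hasWindingNumber hBd hB hxy hγ hcl h,
    logVar_congr fun z hz => hBz (γ z) (hγS z hz).1 (by simpa using (hγS z hz).2),
    logVar_mul (g' := fun z => (stereo e₁ e₂ N (γ z) - stereo e₁ e₂ N p) *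
      (starRingEnd ℂ) (stereo e₁ e₂ N (γ z) - stereo e₁ e₂ N q)) hxy h1c
      (fun z hz => Complex.ofReal_ne_zero.2 (hpos z hz).ne') (hpc.mul hqc')
      (fun z hz => mul_ne_zero (hne hp hγp z hz) (hq0' z hz)),
    logVar_mul hxy hpc (hne hp hγp) hqc' hq0', logVar_conj hxy hqc (hne hq hγq),
    conj_logVar_eq_neg hxy hqc (hne hq hγq) (by simp only [hcl]),
    logVar_of_slitPlane hxy h1c (fun z hz => Or.inl (by simpa using hpos z hz))]
  simp only [hcl]
  ring

/-! ### The heights of a shortcut bound the indices of the crossings. -/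

namespace Shortcut

variable {K : KnotoidDiagram} (a : Shortcut K)

theorem mem_intersections {x u : ℝ} (hx : x ∈ Ioo (0 : ℝ) 1) (hu : u ∈ Icc (0 : ℝ) 1)
    (h : K.toFun x = a.toFun u) : (x, u) ∈ a.intersections := by
  refine ⟨hx, ⟨lt_of_le_of_ne hu.1 ?_, lt_of_le_of_ne hu.2 ?_⟩, h⟩
  · rintro rfl
    exact K.ne_tail hx (h.trans a.map_zero)
  · rintro rfl
    exact K.ne_head hx (h.trans a.map_one)

-- The index is the sum of the signs of the intersections of the loop with the shortcut. These have
-- diagram parameter in `(x, y)`, so at most `posHeight` of them count `+1` and at most `negHeight`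
-- count `-1`.
open Classical in
theorem index_mem {c : ℝ × ℝ} (hc : c ∈ K.crossings) {n : ℤ} (hn : K.HasIndex c n) :
    -(a.negHeight : ℤ) ≤ n ∧ n ≤ a.posHeight := by
  obtain ⟨x, y⟩ := c
  obtain ⟨hd, hlt⟩ := hc
  simp only at hd hlt
  have hsub := KnotoidDiagram.IsDouble.Icc_subset hd
  obtain ⟨N, hN, hne⟩ := exists_notMem_curves K.smooth a.smooth
  obtain ⟨e₁, e₂, hf⟩ := exists_isFrame hN
  have hfin : a.intersections.Finite := a.finite_inter
  set Z : Finset (ℝ × ℝ) := hfin.toFinset.filter fun z => z.1 ∈ Ioo x y with hZ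
  have hmem : ∀ z, z ∈ Z ↔ z ∈ a.intersections ∧ z.1 ∈ Ioo x y := fun z => by simp [hZ]
  have hKS : ∀ s ∈ Icc x y, K.toFun s ∈ S2 \ {N} := fun s hs =>
    ⟨K.mem_sphere s (Ioo_subset_Icc_self (hsub hs)), (hne s).1⟩
  have haS : ∀ u ∈ Icc (0 : ℝ) 1, a.toFun u ∈ S2 \ {N} := fun u hu => ⟨a.mem_sphere u hu, (hne u).2⟩
  have h1 := boundaryVar_stereo_sub hf hN hlt one_pos (K.smooth.differentiable (by simp))
    (a.smooth.differentiable (by simp)) hKS haS Z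
    (fun z hz => ⟨((hmem z).1 hz).2, ((hmem z).1 hz).1.2.1⟩)
    (fun z hz => by
      rw [hmem]
      -- There is no zero on the boundary of the rectangle: the shortcut avoids the crossing `K x =
      -- K y`, and the loop avoids the ends of the shortcut.
      refine ⟨fun h => ⟨a.mem_intersections (hsub hz.1) hz.2 h, lt_of_le_of_ne hz.1.1 ?_,
        lt_of_le_of_ne hz.1.2 ?_⟩, fun h => h.1.2.2⟩
      · intro hx
        exact a.avoids_crossings x y hd z.2 hz.2 (by rw [← h, ← hx])
      · intro hy
        exact a.avoids_crossings y x hd.symm z.2 hz.2 (by rw [← h, hy]))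
    (fun z hz => by
      have hz' := ((hmem z).1 hz).1
      have := a.transverse z.1 hz'.1 z.2 hz'.2.1 hz'.2.2
      rw [det3_eq] at this ⊢
      exact fun h0 => this (by linarith))
  have h2 := logVar_stereo_of_hasWindingNumber hf hN hlt.le K.continuous.continuousOn hd.2.2.2 hKS
    (⟨K.tail_mem, (hne 0).1⟩ : K.tail ∈ S2 \ {N}) (⟨K.head_mem, (hne 1).1⟩ : K.head ∈ S2 \ {N})
    (fun z hz => K.ne_tail (hsub hz)) (fun z hz => K.ne_head (hsub hz)) hn
  have h3 : boundaryVar (fun z => stereo e₁ e₂ N (K.toFun z.1) - stereo e₁ e₂ N (a.toFun z.2))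
      x y 0 1 = 2 * Real.pi * Complex.I * n := by
    -- The sides over `s = x` and `s = y` cancel because the loop closes; the other two see it from
    -- the tail and from the head.
    rw [← h2]
    unfold boundaryVar
    simp only [a.map_zero, a.map_one, hd.2.2.2]
    ring
  rw [h3, ← Finset.sum_neg_distrib] at h1
  have hn' : n = ∑ z ∈ Z,
      -(SignType.sign (det3 (K.toFun z.1) (deriv K.toFun z.1) (deriv a.toFun z.2)) : ℤ) := by
    have h2pi : (2 * Real.pi * Complex.I : ℂ) ≠ 0 := by simp
    exact_mod_cast mul_left_cancel₀ h2pi h1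
  -- Heights put the tangent of the shortcut first; the exchange absorbs the minus sign of
  -- `boundaryVar_stereo_sub`.
  have hswap : ∀ z : ℝ × ℝ,
      -(SignType.sign (det3 (K.toFun z.1) (deriv K.toFun z.1) (deriv a.toFun z.2)) : ℤ) =
      SignType.sign (det3 (K.toFun z.1) (deriv a.toFun z.2) (deriv K.toFun z.1)) := fun z => by
    rw [← sign_cast_neg]
    congr 2
    rw [det3_eq, det3_eq]
    ring
  simp only [hswap] at hn'
  have hposN : (Z.filter fun z =>
      0 < det3 (K.toFun z.1) (deriv a.toFun z.2) (deriv K.toFun z.1)).card ≤ a.posHeight := by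
    rw [← Set.ncard_coe_finset]
    refine Set.ncard_le_ncard (fun z hz => ?_) (hfin.subset fun z hz => hz.1)
    simp only [Finset.coe_filter, mem_ofPred_eq] at hz
    exact ⟨((hmem z).1 hz.1).1, hz.2⟩
  have hnegN : (Z.filter fun z =>
      det3 (K.toFun z.1) (deriv a.toFun z.2) (deriv K.toFun z.1) < 0).card ≤ a.negHeight := by
    rw [← Set.ncard_coe_finset]
    refine Set.ncard_le_ncard (fun z hz => ?_) (hfin.subset fun z hz => hz.1)
    simp only [Finset.coe_filter, mem_ofPred_eq] at hz
    exact ⟨((hmem z).1 hz.1).1, hz.2⟩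
  constructor
  · refine (neg_le_neg (Int.ofNat_le.2 hnegN)).trans ?_
    rw [hn', Finset.card_filter, Nat.cast_sum, ← Finset.sum_neg_distrib]
    refine Finset.sum_le_sum fun z _ => ?_
    split_ifs with h
    · rw [sign_neg h]; simp
    · rcases (not_lt.1 h).eq_or_lt with h | h
      · rw [← h]; simp
      · rw [sign_pos h]; simp
  · refine le_trans ?_ (Int.ofNat_le.2 hposN)
    rw [hn', Finset.card_filter, Nat.cast_sum]
    refine Finset.sum_le_sum fun z _ => ?_
    split_ifs with h
    · rw [sign_pos h]; simp
    · rcases (not_lt.1 h).eq_or_lt with h | h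
      · rw [h]; simp
      · rw [sign_neg h]; simp

theorem degPos_le (a : Shortcut K) : degPos K.indexPolynomial ≤ a.posHeight ∧
    degNeg K.indexPolynomial ≤ a.negHeight :=
  K.degPos_degNeg_le fun n hn => by
    obtain ⟨c, hc, hi⟩ := K.exists_crossing hn
    exact a.index_mem hc hi

end Shortcut

/-! ### Change of the parameter -/

theorem deriv_eq_of_eqOn {γ γ' : ℝ → E3} {x : ℝ} {S : Set ℝ} (hS : S ∈ 𝓝 x)
    (h : ∀ z ∈ S, γ' z = γ z) : deriv γ' x = deriv γ x :=
  Filter.EventuallyEq.deriv_eq (by filter_upwards [hS] with z hz using h z hz)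

/-- `ρ` is an increasing bijection of `[0,1]`, so it matches the crossings; composing an angular
coordinate with `ρ` preserves indices, and tangents are scaled by positive factors. -/
theorem writhe_eq_of_reparam {K K' : KnotoidDiagram} {ρ : ℝ → ℝ} (smooth : ContDiff ℝ ∞ ρ)
    (deriv_pos : ∀ x ∈ Icc (0 : ℝ) 1, 0 < deriv ρ x) (zero : ρ 0 = 0) (one : ρ 1 = 1)
    (eq_comp : ∀ x ∈ Icc (0 : ℝ) 1, K'.toFun x = K.toFun (ρ x))
    (over_comp : ∀ x y, IsDouble K'.toFun x y → (K'.isOver x y ↔ K.isOver (ρ x) (ρ y))) (n : ℤ) :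
    K.writhe n = K'.writhe n := by
  have hmono : StrictMonoOn ρ (Icc 0 1) :=
    strictMonoOn_of_deriv_pos (convex_Icc 0 1) smooth.continuous.continuousOn fun x hx =>
      deriv_pos x (interior_subset hx)
  have h0 : (0 : ℝ) ∈ Icc (0 : ℝ) 1 := by simp
  have h1 : (1 : ℝ) ∈ Icc (0 : ℝ) 1 := by simp
  have hmaps : MapsTo ρ (Icc 0 1) (Icc 0 1) := fun x hx =>
    ⟨zero ▸ hmono.monotoneOn h0 hx hx.1, one ▸ hmono.monotoneOn hx h1 hx.2⟩
  have hmaps' : MapsTo ρ (Ioo 0 1) (Ioo 0 1) := fun x hx =>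
    ⟨zero ▸ hmono h0 (Ioo_subset_Icc_self hx) hx.1, one ▸ hmono (Ioo_subset_Icc_self hx) h1 hx.2⟩
  have hsurj : SurjOn ρ (Icc 0 1) (Icc 0 1) := by
    have := intermediate_value_Icc zero_le_one (f := ρ) smooth.continuous.continuousOn
    rwa [zero, one] at this
  have hdbl : ∀ x ∈ Icc (0 : ℝ) 1, ∀ y ∈ Icc (0 : ℝ) 1,
      (IsDouble K'.toFun x y ↔ IsDouble K.toFun (ρ x) (ρ y)) := fun x hx y hy => by
    simp only [IsDouble, eq_comp x hx, eq_comp y hy, hx, hy, hmaps hx, hmaps hy, true_and, ne_eq,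
      hmono.injOn.eq_iff hx hy]
  have htail : K'.tail = K.tail := by rw [KnotoidDiagram.tail, eq_comp 0 h0, zero]; rfl
  have hhead : K'.head = K.head := by rw [KnotoidDiagram.head, eq_comp 1 h1, one]; rfl
  obtain ⟨u, w, hdet⟩ := exists_det3_pos (sub_ne_zero.2 K.tail_ne_head)
  obtain ⟨ℓ, hl⟩ := K.exists_isLog_axisCurve hdet
  have hl' : IsLog (fun x => ℓ (ρ x)) (K'.axisCurve u w) (Ioo 0 1) :=
    (hl.comp smooth.continuous.continuousOn hmaps').congr fun x hx => by
      rw [KnotoidDiagram.axisCurve, KnotoidDiagram.axisCurve, htail, hhead,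
        eq_comp x (Ioo_subset_Icc_self hx)]
  have hindex : ∀ x y, IsDouble K'.toFun x y → x < y → ∀ n,
      (K'.HasIndex (x, y) n ↔ K.HasIndex (ρ x, ρ y) n) := fun x y hd hxy n => by
    rw [KnotoidDiagram.hasIndex_iff (htail ▸ hhead ▸ hdet) hl' hd hxy,
      KnotoidDiagram.hasIndex_iff hdet hl ((hdbl x hd.1 y hd.2.1).1 hd) (hmono hd.1 hd.2.1 hxy)]
  have hderiv : ∀ x ∈ Ioo (0 : ℝ) 1, deriv K'.toFun x = deriv ρ x • deriv K.toFun (ρ x) :=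
    fun x hx => by
      rw [deriv_eq_of_eqOn (isOpen_Ioo.mem_nhds hx) fun z hz => eq_comp z (Ioo_subset_Icc_self hz)]
      exact ((K.hasDerivAt (ρ x)).scomp x (smooth.differentiable (by simp) x).hasDerivAt).deriv
  have hminmax : ∀ x ∈ Icc (0 : ℝ) 1, ∀ y ∈ Icc (0 : ℝ) 1,
      ρ (min x y) = min (ρ x) (ρ y) ∧ ρ (max x y) = max (ρ x) (ρ y) := fun x hx y hy => by
    rcases le_total x y with h | h
    · have := hmono.monotoneOn hx hy h
      rw [min_eq_left h, max_eq_right h, min_eq_left this, max_eq_right this]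
      exact ⟨rfl, rfl⟩
    · have := hmono.monotoneOn hy hx h
      rw [min_eq_right h, max_eq_left h, min_eq_right this, max_eq_left this]
      exact ⟨rfl, rfl⟩
  have hpairs : ∀ x ∈ Icc (0 : ℝ) 1, ∀ y ∈ Icc (0 : ℝ) 1,
      ((x, y) ∈ K'.overPairs n ↔ (ρ x, ρ y) ∈ K.overPairs n) := fun x hx y hy => by
    simp only [KnotoidDiagram.overPairs, mem_ofPred_eq]
    rw [← hdbl x hx y hy]
    refine and_congr_right fun hd => ?_
    rw [over_comp x y hd, ← (hminmax x hx y hy).1, ← (hminmax x hx y hy).2]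
    refine and_congr_right fun _ => ?_
    rcases lt_or_gt_of_ne hd.2.2.1 with h | h
    · rw [min_eq_left h.le, max_eq_right h.le]
      exact hindex x y hd h n
    · rw [min_eq_right h.le, max_eq_left h.le]
      exact hindex y x hd.symm h n
  rw [K.writhe_eq, K'.writhe_eq]
  congr 1
  symm
  refine finsum_mem_eq_of_bijOn (fun c => (ρ c.1, ρ c.2)) ⟨?_, ?_, ?_⟩ ?_
  · rintro ⟨x, y⟩ hc
    exact (hpairs x hc.1.1 y hc.1.2.1).1 hc
  · rintro ⟨x, y⟩ hc ⟨x', y'⟩ hc' h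
    simp only [Prod.mk.injEq] at h
    exact Prod.ext (hmono.injOn hc.1.1 hc'.1.1 h.1) (hmono.injOn hc.1.2.1 hc'.1.2.1 h.2)
  · rintro ⟨x, y⟩ hc
    obtain ⟨x', hx', rfl⟩ := hsurj hc.1.1
    obtain ⟨y', hy', rfl⟩ := hsurj hc.1.2.1
    exact ⟨(x', y'), (hpairs x' hx' y' hy').2 hc, rfl⟩
  · rintro ⟨x, y⟩ hc
    have hx := K'.double_interior x y hc.1
    have hy := K'.double_interior y x hc.1.symm
    have hsm : ∀ (r s : ℝ) (P v w : E3), det3 P (r • v) (s • w) = r * s * det3 P v w :=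
      fun r s P v w => by
        simp only [det3_eq, PiLp.smul_apply, smul_eq_mul]; ring
    simp only [KnotoidDiagram.pairSign]
    rw [hderiv x hx, hderiv y hy, eq_comp x hc.1.1, hsm, sign_mul, sign_pos (mul_pos
      (deriv_pos x hc.1.1) (deriv_pos y hc.1.2.1)), one_mul]

theorem HasWindingNumber.congr {γ γ' : ℝ → E3} {x y : ℝ} {p q : E3} {n : ℤ}
    (h : ∀ z ∈ Icc x y, γ z = γ' z) :
    HasWindingNumber γ x y p q n ↔ HasWindingNumber γ' x y p q n := by
  unfold HasWindingNumber
  refine exists_congr fun u => exists_congr fun w => and_congr_right fun _ => exists_congr fun r =>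
    exists_congr fun θ => exists_congr fun ζ => and_congr_right fun _ => and_congr_left fun _ =>
    forall₂_congr fun z hz => ?_
  rw [h z hz]

/-! ### Isotopy of the sphere -/

namespace SphereIsotopy

variable (Φ : SphereIsotopy)

theorem injOn (τ : ℝ) : InjOn (Φ.toFun τ) S2 := fun P hP Q hQ h => by
  rw [← Φ.left_inv τ P hP, h, Φ.left_inv τ Q hQ]

theorem continuous_apply (P : E3) : Continuous fun τ => Φ.toFun τ P := by
  have h : Continuous (Function.uncurry Φ.toFun ∘ fun τ : ℝ => (τ, P)) :=
    Φ.smooth.continuous.comp (by fun_prop)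
  exact h

theorem continuousOn_comp {X : Type*} [TopologicalSpace X] {S : Set X} {f : X → ℝ} {g : X → E3}
    (hf : ContinuousOn f S) (hg : ContinuousOn g S) :
    ContinuousOn (fun x => Φ.toFun (f x) (g x)) S := by
  have h : ContinuousOn (Function.uncurry Φ.toFun ∘ fun x => (f x, g x)) S :=
    Φ.smooth.continuous.comp_continuousOn (hf.prodMk hg)
  exact h

/-- The derivative of the map at time `τ`. -/
def spaceDeriv (τ : ℝ) (P v : E3) : E3 := fderiv ℝ (Function.uncurry Φ.toFun) (τ, P) (0, v)

theorem continuous_spaceDeriv (P v : E3) : Continuous fun τ => Φ.spaceDeriv τ P v := by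
  unfold spaceDeriv
  have h1 : Continuous (fderiv ℝ (Function.uncurry Φ.toFun)) :=
    Φ.smooth.continuous_fderiv (by simp)
  have h2 : Continuous (fderiv ℝ (Function.uncurry Φ.toFun) ∘ fun τ : ℝ => (τ, P)) :=
    h1.comp (by fun_prop)
  exact h2.clm_apply continuous_const

theorem hasDerivAt_comp {γ : ℝ → E3} {v : E3} {s : ℝ} (h : HasDerivAt γ v s) (τ : ℝ) :
    HasDerivAt (fun z => Φ.toFun τ (γ z)) (Φ.spaceDeriv τ (γ s) v) s := by
  have h1 : HasFDerivAt (Function.uncurry Φ.toFun) (fderiv ℝ (Function.uncurry Φ.toFun) (τ, γ s))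
      (τ, γ s) := ((Φ.smooth.differentiable (by simp)) _).hasFDerivAt
  exact h1.comp_hasDerivAt s ((hasDerivAt_const s τ).prodMk h)

/-- An isotopy preserves the orientation of pairs of tangents. -/
theorem det3_spaceDeriv_ne_zero {γ δ : ℝ → E3} {v w : E3} {x y : ℝ} (hγ : HasDerivAt γ v x)
    (hδ : HasDerivAt δ w y) (hγS : ∀ᶠ z in 𝓝 x, γ z ∈ S2) (hδS : ∀ᶠ z in 𝓝 y, δ z ∈ S2)
    (heq : γ x = δ y) (h : det3 (γ x) v w ≠ 0) (τ : ℝ) :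
    det3 (Φ.toFun τ (γ x)) (Φ.spaceDeriv τ (γ x) v) (Φ.spaceDeriv τ (γ x) w) ≠ 0 := by
  have hxS : γ x ∈ S2 := hγS.self_of_nhds
  have hγ' := Φ.hasDerivAt_comp hγ τ
  have hδ' := Φ.hasDerivAt_comp hδ τ
  rw [← heq] at hδ'
  have ht1 := dot3_deriv_eq_zero hγ' (hγS.mono fun z hz => Φ.mapsTo τ hz)
  have ht2 := dot3_deriv_eq_zero hδ' (hδS.mono fun z hz => Φ.mapsTo τ hz)
  rw [← heq] at ht2
  have hP := mem_S2_iff.1 (Φ.mapsTo τ hxS)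
  set P := Φ.toFun τ (γ x)
  set v' := Φ.spaceDeriv τ (γ x) v
  set w' := Φ.spaceDeriv τ (γ x) w
  -- The derivative of the inverse map takes `v'`, `w'` back to `v`, `w`. As the maps are inverse to
  -- each other on the sphere only, this is read off along the curves.
  obtain ⟨A, hA⟩ : ∃ A : E3 →L[ℝ] E3, A v' = v ∧ A w' = w := by
    have hi : HasFDerivAt (Φ.inv τ) (fderiv ℝ (Φ.inv τ) P) P := by
      have : ContDiff ℝ ∞ (Φ.inv τ) := Φ.inv_smooth.comp (contDiff_const.prodMk contDiff_id)
      exact (this.differentiable (by simp) P).hasFDerivAt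
    refine ⟨fderiv ℝ (Φ.inv τ) P, ?_, ?_⟩
    · refine ((hi.comp_hasDerivAt x hγ').congr_of_eventuallyEq ?_).unique hγ
      filter_upwards [hγS] with z hz using (Φ.left_inv τ _ hz).symm
    · have hi' : HasFDerivAt (Φ.inv τ) (fderiv ℝ (Φ.inv τ) P) (Φ.toFun τ (δ y)) := by
        rwa [← heq]
      refine ((hi'.comp_hasDerivAt y hδ').congr_of_eventuallyEq ?_).unique hδ
      filter_upwards [hδS] with z hz using (Φ.left_inv τ _ hz).symm
  intro h0
  -- For tangent vectors a zero determinant means equality in Cauchy–Schwarz, so `v'` and `w'` are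
  -- parallel, and then so are `v` and `w`.
  have hgram := gram P P v' w'
  rw [h0, hP, ht1, ht2] at hgram
  have hpar : dot3 v' v' • w' = dot3 v' w' • v' := by
    rw [← dot3_sub_self_eq_zero]
    have : dot3 (dot3 v' v' • w' - dot3 v' w' • v') (dot3 v' v' • w' - dot3 v' w' • v') =
        dot3 v' v' * (dot3 v' v' * dot3 w' w' - dot3 v' w' ^ 2) := by
      simp [dot3]; ring
    rw [this]
    linear_combination -dot3 v' v' * hgram
  have hpar' : dot3 v' v' • w = dot3 v' w' • v := by
    rw [← hA.1, ← hA.2, ← map_smul, ← map_smul]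
    rw [hpar]
  by_cases hv : dot3 v' v' = 0
  · have hv' : v' = 0 := dot3_sub_self_eq_zero.1 (by rwa [sub_zero])
    rw [hv', _root_.map_zero] at hA
    apply h
    rw [← hA.1, det3_eq]
    simp
  · have h1 : dot3 v' v' * det3 (γ x) v w = det3 (γ x) v (dot3 v' v' • w) := by
      simp only [det3_eq, PiLp.smul_apply, smul_eq_mul]; ring
    rw [hpar'] at h1
    have h2 : det3 (γ x) v (dot3 v' w' • v) = 0 := by
      simp only [det3_eq, PiLp.smul_apply, smul_eq_mul]; ring
    exact (mul_ne_zero hv h) (h1.trans h2)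

/-- The determinant is continuous in time and never zero, so its sign is constant; at time zero the
map is the identity on the sphere. -/
theorem sign_det3_spaceDeriv {γ δ : ℝ → E3} {v w : E3} {x y : ℝ} (hγ : HasDerivAt γ v x)
    (hδ : HasDerivAt δ w y) (hγS : ∀ᶠ z in 𝓝 x, γ z ∈ S2) (hδS : ∀ᶠ z in 𝓝 y, δ z ∈ S2)
    (heq : γ x = δ y) (h : det3 (γ x) v w ≠ 0) (τ : ℝ) :
    SignType.sign (det3 (Φ.toFun τ (γ x)) (Φ.spaceDeriv τ (γ x) v) (Φ.spaceDeriv τ (γ x) w)) =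
      SignType.sign (det3 (γ x) v w) := by
  have hne := Φ.det3_spaceDeriv_ne_zero hγ hδ hγS hδS heq h
  have hcont : Continuous fun τ =>
      det3 (Φ.toFun τ (γ x)) (Φ.spaceDeriv τ (γ x) v) (Φ.spaceDeriv τ (γ x) w) :=
    (Φ.continuous_apply _).det3 (Φ.continuous_spaceDeriv _ _) (Φ.continuous_spaceDeriv _ _)
  have hconst : ∀ τ τ', SignType.sign (det3 (Φ.toFun τ (γ x)) (Φ.spaceDeriv τ (γ x) v)
      (Φ.spaceDeriv τ (γ x) w)) = SignType.sign (det3 (Φ.toFun τ' (γ x))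
      (Φ.spaceDeriv τ' (γ x) v) (Φ.spaceDeriv τ' (γ x) w)) := fun τ τ' => by
    refine PreconnectedSpace.constant inferInstance (f := fun τ => SignType.sign
      (det3 (Φ.toFun τ (γ x)) (Φ.spaceDeriv τ (γ x) v) (Φ.spaceDeriv τ (γ x) w))) ?_
    rw [continuous_iff_continuousAt]
    intro τ
    exact ContinuousAt.comp (continuousAt_sign_of_ne_zero (hne τ)) hcont.continuousAt
  rw [hconst τ 0]
  have hz1 : Φ.spaceDeriv 0 (γ x) v = v :=
    ((Φ.hasDerivAt_comp hγ 0).congr_of_eventuallyEq (by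
      filter_upwards [hγS] with z hz using (Φ.map_zero _ hz).symm)).unique hγ
  have hz2 : Φ.spaceDeriv 0 (γ x) w = w := by
    rw [heq]
    exact ((Φ.hasDerivAt_comp hδ 0).congr_of_eventuallyEq (by
      filter_upwards [hδS] with z hz using (Φ.map_zero _ hz).symm)).unique hδ
  rw [hz1, hz2, Φ.map_zero _ hγS.self_of_nhds]

/-- An isotopy preserves winding numbers. -/
theorem hasWindingNumber_iff {γ : ℝ → E3} {x y : ℝ} {p q : E3} {n : ℤ} (hxy : x ≤ y)
    (hγ : ContinuousOn γ (Icc x y)) (hcl : γ x = γ y) (hγS : ∀ z ∈ Icc x y, γ z ∈ S2)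
    (hp : p ∈ S2) (hq : q ∈ S2) (hpq : p ≠ q) (hγp : ∀ z ∈ Icc x y, γ z ≠ p)
    (hγq : ∀ z ∈ Icc x y, γ z ≠ q) (τ : ℝ) :
    HasWindingNumber (fun z => Φ.toFun τ (γ z)) x y (Φ.toFun τ p) (Φ.toFun τ q) n ↔
      HasWindingNumber γ x y p q n := by
  have hΦγ : ∀ τ, ContinuousOn (fun z => Φ.toFun τ (γ z)) (Icc x y) := fun τ =>
    Φ.continuousOn_comp continuousOn_const hγ
  -- Near `τ₀` one pair `u, w` stays positive for the moving axis, and the projected loops have a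
  -- joint logarithm in time and parameter. Its values over `x` and over `y` are logarithms of the
  -- same function of time, so their difference is constant.
  have hloc : ∀ τ₀, ∀ᶠ τ in 𝓝 τ₀,
      (HasWindingNumber (fun z => Φ.toFun τ (γ z)) x y (Φ.toFun τ p) (Φ.toFun τ q) n ↔
        HasWindingNumber (fun z => Φ.toFun τ₀ (γ z)) x y (Φ.toFun τ₀ p) (Φ.toFun τ₀ q) n) := by
    intro τ₀
    obtain ⟨u, w, hdet⟩ := exists_det3_pos
      (sub_ne_zero.2 fun h => hpq (Φ.injOn τ₀ hp hq h))
    have hopen : ∀ᶠ τ in 𝓝 τ₀, 0 < det3 u w (Φ.toFun τ p - Φ.toFun τ q) := by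
      have : Continuous fun τ => det3 u w (Φ.toFun τ p - Φ.toFun τ q) :=
        continuous_const.det3 continuous_const
          ((Φ.continuous_apply p).sub (Φ.continuous_apply q))
      exact this.continuousAt.eventually (lt_mem_nhds hdet)
    obtain ⟨ε, hε, hball⟩ := Metric.eventually_nhds_iff_ball.1 hopen
    filter_upwards [Metric.ball_mem_nhds τ₀ hε] with τ hτ
    set G : ℝ × ℝ → ℂ := fun z => axisProj u w (Φ.toFun z.1 p - Φ.toFun z.1 q)
      (Φ.toFun z.1 (γ z.2) - Φ.toFun z.1 p) with hG
    have hG0 : ∀ z ∈ Metric.ball τ₀ ε ×ˢ Icc x y, G z ≠ 0 := fun z hz =>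
      axisProj_ne_zero (hball _ hz.1) (Φ.mapsTo _ hp) (Φ.mapsTo _ hq) (Φ.mapsTo _ (hγS _ hz.2))
        (fun h => hγp _ hz.2 (Φ.injOn _ (hγS _ hz.2) hp h))
        (fun h => hγq _ hz.2 (Φ.injOn _ (hγS _ hz.2) hq h))
    have hGc : ContinuousOn G (Metric.ball τ₀ ε ×ˢ Icc x y) := by
      have hP : ∀ P, ContinuousOn (fun z : ℝ × ℝ => Φ.toFun z.1 P) (Metric.ball τ₀ ε ×ˢ Icc x y) :=
        fun P => Φ.continuousOn_comp continuousOn_fst continuousOn_const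
      have hd := (hP p).sub (hP q)
      have hX := (Φ.continuousOn_comp continuousOn_fst
        (hγ.comp continuousOn_snd fun z hz => hz.2)).sub (hP p)
      simp only [hG, axisProj_apply]
      exact (Complex.continuous_ofReal.comp_continuousOn (hX.det3 continuousOn_const hd)).add
        ((Complex.continuous_ofReal.comp_continuousOn (continuousOn_const.det3 hX hd)).mul
          continuousOn_const)
    obtain ⟨ℓ, hl⟩ := exists_isLog ((convex_ball τ₀ ε).prod (convex_Icc x y)) hGc hG0
    have hside : ∀ σ ∈ Metric.ball τ₀ ε, IsLog (fun z => ℓ (σ, z)) (fun z => G (σ, z)) (Icc x y) :=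
      fun σ hσ => hl.comp (φ := fun z => (σ, z)) (by fun_prop) fun z hz => ⟨hσ, hz⟩
    have hiff : ∀ σ ∈ Metric.ball τ₀ ε,
        (HasWindingNumber (fun z => Φ.toFun σ (γ z)) x y (Φ.toFun σ p) (Φ.toFun σ q) n ↔
          ℓ (σ, y) - ℓ (σ, x) = 2 * Real.pi * Complex.I * n) := fun σ hσ => by
      rw [← (hside σ hσ).logVar_eq hxy]
      exact Knotoids.hasWindingNumber_iff (hball σ hσ) hxy (hΦγ σ) (by simp only [hcl])
        fun z hz => hG0 (σ, z) ⟨hσ, hz⟩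
    have hτ₀ := Metric.mem_ball_self (x := τ₀) hε
    have hx := left_mem_Icc.2 hxy
    have hy := right_mem_Icc.2 hxy
    have hlx : IsLog (fun σ => ℓ (σ, x)) (fun σ => G (σ, x)) (Metric.ball τ₀ ε) :=
      hl.comp (φ := fun σ => (σ, x)) (by fun_prop) fun σ hσ => ⟨hσ, hx⟩
    have hly : IsLog (fun σ => ℓ (σ, y)) (fun σ => G (σ, x)) (Metric.ball τ₀ ε) :=
      (hl.comp (φ := fun σ => (σ, y)) (by fun_prop) fun σ hσ => ⟨hσ, hy⟩).congr
        fun σ _ => by simp only [hG, hcl]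
    have hcomm := hlx.sub_eq_sub hly (convex_ball τ₀ ε).isPreconnected hτ₀ hτ
    rw [hiff τ hτ, hiff τ₀ hτ₀, show ℓ (τ, y) - ℓ (τ, x) = ℓ (τ₀, y) - ℓ (τ₀, x) by
      linear_combination -hcomm]
  have hconst : IsLocallyConstant fun τ =>
      HasWindingNumber (fun z => Φ.toFun τ (γ z)) x y (Φ.toFun τ p) (Φ.toFun τ q) n :=
    IsLocallyConstant.iff_eventually_eq _ |>.2 fun τ₀ => (hloc τ₀).mono fun τ h => propext h
  rw [hconst.apply_eq_of_preconnectedSpace τ 0, Φ.map_zero p hp, Φ.map_zero q hq]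
  exact HasWindingNumber.congr fun z hz => Φ.map_zero _ (hγS z hz)

end SphereIsotopy

theorem writhe_eq_of_isotopy {K K' : KnotoidDiagram} (Φ : SphereIsotopy)
    (eq_comp : ∀ x ∈ Icc (0 : ℝ) 1, K'.toFun x = Φ.toFun 1 (K.toFun x))
    (over_eq : ∀ x y, IsDouble K'.toFun x y → (K'.isOver x y ↔ K.isOver x y)) (n : ℤ) :
    K.writhe n = K'.writhe n := by
  have hdbl : ∀ x y, IsDouble K'.toFun x y ↔ IsDouble K.toFun x y := fun x y => by
    refine and_congr_right fun hx => and_congr_right fun hy => and_congr_right fun _ => ?_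
    rw [eq_comp x hx, eq_comp y hy,
      (Φ.injOn 1).eq_iff (K.mem_sphere x hx) (K.mem_sphere y hy)]
  have hindex : ∀ x y, IsDouble K.toFun x y → x < y → ∀ n,
      (K'.HasIndex (x, y) n ↔ K.HasIndex (x, y) n) := fun x y hd hxy n => by
    have hsub := KnotoidDiagram.IsDouble.Icc_subset hd
    have := Φ.hasWindingNumber_iff (n := n) hxy.le K.continuous.continuousOn hd.2.2.2
      (fun z hz => K.mem_sphere z (Ioo_subset_Icc_self (hsub hz))) K.tail_mem K.head_mem
      K.tail_ne_head (fun z hz => K.ne_tail (hsub hz)) (fun z hz => K.ne_head (hsub hz)) 1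
    rw [KnotoidDiagram.HasIndex, KnotoidDiagram.HasIndex, ← this, KnotoidDiagram.tail,
      KnotoidDiagram.head, eq_comp 0 (by simp), eq_comp 1 (by simp)]
    exact HasWindingNumber.congr fun z hz => (eq_comp z (Ioo_subset_Icc_self (hsub hz)))
  have hpairs : K'.overPairs n = K.overPairs n := by
    ext ⟨x, y⟩
    simp only [KnotoidDiagram.overPairs, mem_ofPred_eq]
    rw [hdbl]
    refine and_congr_right fun hd => ?_
    rw [over_eq x y ((hdbl x y).2 hd)]
    refine and_congr_right fun _ => ?_
    rcases lt_or_gt_of_ne hd.2.2.1 with h | h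
    · rw [min_eq_left h.le, max_eq_right h.le]
      exact hindex x y hd h n
    · rw [min_eq_right h.le, max_eq_left h.le]
      exact hindex y x hd.symm h n
  rw [K.writhe_eq, K'.writhe_eq, hpairs]
  congr 1
  refine finsum_mem_congr rfl ?_
  rintro ⟨x, y⟩ ⟨hd, -⟩
  simp only at hd
  have hnhds : ∀ {z : ℝ}, z ∈ Ioo (0 : ℝ) 1 → ∀ᶠ s in 𝓝 z, K.toFun s ∈ S2 := fun hz => by
    filter_upwards [isOpen_Ioo.mem_nhds hz] with s hs using K.mem_sphere s (Ioo_subset_Icc_self hs)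
  have hderiv : ∀ z ∈ Ioo (0 : ℝ) 1,
      deriv K'.toFun z = Φ.spaceDeriv 1 (K.toFun z) (deriv K.toFun z) := fun z hz => by
    rw [deriv_eq_of_eqOn (isOpen_Ioo.mem_nhds hz) fun s hs => eq_comp s (Ioo_subset_Icc_self hs)]
    exact (Φ.hasDerivAt_comp (K.hasDerivAt z) 1).deriv
  have hx := K.double_interior x y hd
  have hy := K.double_interior y x hd.symm
  rw [KnotoidDiagram.pairSign, KnotoidDiagram.pairSign, hderiv x hx, hderiv y hy,
    eq_comp x hd.1, ← hd.2.2.2, Φ.sign_det3_spaceDeriv (K.hasDerivAt x) (K.hasDerivAt y)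
      (hnhds hx) (hnhds hy) hd.2.2.2 (K.transverse x y hd)]

/-! ### Diagrams that differ in a disk -/

namespace SphereDisk

variable (D : SphereDisk)

/-- The inverse of the parametrization of a disk. -/
def inv : E3 → ℂ := Function.invFunOn D.toFun (Metric.closedBall 0 1)

theorem inv_mem {P : E3} (hP : P ∈ D.carrier) : D.inv P ∈ Metric.closedBall (0 : ℂ) 1 :=
  Function.invFunOn_mem hP

theorem apply_inv {P : E3} (hP : P ∈ D.carrier) : D.toFun (D.inv P) = P :=
  Function.invFunOn_eq hP

theorem inv_apply {z : ℂ} (hz : z ∈ Metric.closedBall (0 : ℂ) 1) : D.inv (D.toFun z) = z :=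
  D.injOn.leftInvOn_invFunOn hz

/-- A continuous injection of a compact set into a Hausdorff space is a homeomorphism onto its
image. -/
theorem continuousOn_inv : ContinuousOn D.inv D.carrier := by
  rw [continuousOn_iff_isClosed]
  intro t ht
  refine ⟨D.toFun '' (Metric.closedBall 0 1 ∩ t), ?_, ?_⟩
  · exact (((isCompact_closedBall 0 1).inter_right ht).image_of_continuousOn
      (D.continuousOn.mono inter_subset_left)).isClosed
  · ext P
    constructor
    · rintro ⟨h, hP⟩
      exact ⟨⟨D.inv P, ⟨D.inv_mem hP, h⟩, D.apply_inv hP⟩, hP⟩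
    · rintro ⟨⟨z, ⟨hz, hzt⟩, rfl⟩, hP⟩
      exact ⟨by rwa [mem_preimage, D.inv_apply hz], hP⟩

theorem carrier_subset : D.carrier ⊆ S2 := by
  rintro _ ⟨z, hz, rfl⟩
  exact D.mapsTo hz

/-- The disk without a boundary point is simply connected. -/
theorem convex_sdiff_boundary {P : E3} (hP : P ∈ D.carrier) (hP' : P ∉ D.interior) :
    Convex ℝ (Metric.closedBall (0 : ℂ) 1 \ {D.inv P}) := by
  -- Boundary points of the round disk are extreme, so removing one leaves a convex set.
  refine ((convex_closedBall 0 1).mem_extremePoints_iff_convex_sdiff.1 ?_).2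
  have hmem := D.inv_mem hP
  have : D.inv P ∈ Metric.sphere (0 : ℂ) 1 := by
    rw [mem_sphere_zero_iff_norm]
    rw [mem_closedBall_zero_iff] at hmem
    refine le_antisymm hmem (not_lt.1 fun h => hP' ⟨D.inv P, by simpa using h, D.apply_inv hP⟩)
  rwa [StrictConvexSpace.extremePoints_closedBall_eq_sphere]

end SphereDisk

namespace MeetsDiskIn

variable {K : KnotoidDiagram} {D : SphereDisk} {m : ℕ} {s t : Fin m → ℝ}

theorem Icc_subset (h : MeetsDiskIn K D s t) (i : Fin m) : Icc (s i) (t i) ⊆ Ioo 0 1 :=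
  fun _ hx => ⟨(h.bounds i).1.trans_le hx.1, hx.2.trans_lt (h.bounds i).2.2⟩

theorem mem_of_mem_Icc (h : MeetsDiskIn K D s t) {i : Fin m} {x : ℝ} (hx : x ∈ Icc (s i) (t i)) :
    K.toFun x ∈ D.carrier :=
  (h.mem_carrier x (Ioo_subset_Icc_self (h.Icc_subset i hx))).2 ⟨i, hx⟩

theorem eq_of_mem (h : MeetsDiskIn K D s t) {i j : Fin m} {x : ℝ} (hi : x ∈ Icc (s i) (t i))
    (hj : x ∈ Icc (s j) (t j)) : i = j := by
  by_contra hne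
  exact disjoint_left.1 (h.disjoint i j hne) hi hj

theorem tail_notMem (h : MeetsDiskIn K D s t) : K.tail ∉ D.carrier := fun hK => by
  obtain ⟨i, hi⟩ := (h.mem_carrier 0 (by simp)).1 hK
  exact lt_irrefl _ (h.Icc_subset i hi).1

theorem head_notMem (h : MeetsDiskIn K D s t) : K.head ∉ D.carrier := fun hK => by
  obtain ⟨i, hi⟩ := (h.mem_carrier 1 (by simp)).1 hK
  exact lt_irrefl _ (h.Icc_subset i hi).2

theorem notMem_interior (h : MeetsDiskIn K D s t) {i : Fin m} {x : ℝ} (hx : x ∈ Icc (s i) (t i))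
    (hx' : x ∉ Ioo (s i) (t i)) : K.toFun x ∉ D.interior := fun hK => by
  obtain ⟨j, hj⟩ := (h.mem_interior x (Ioo_subset_Icc_self (h.Icc_subset i hx))).1 hK
  obtain rfl := h.eq_of_mem hx (Ioo_subset_Icc_self hj)
  exact hx' hj

theorem mem_Ioo_of_isDouble (h : MeetsDiskIn K D s t) {x y : ℝ} (hd : IsDouble K.toFun x y)
    {i : Fin m} (hx : x ∈ Icc (s i) (t i)) : x ∈ Ioo (s i) (t i) := by
  by_contra hx'
  exact h.notMem_interior hx hx' (h.no_boundary_crossing x y hd (h.mem_of_mem_Icc hx))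

theorem exists_mem_Ioo_of_isDouble (h : MeetsDiskIn K D s t) {x y : ℝ} (hd : IsDouble K.toFun x y)
    {i : Fin m} (hx : x ∈ Ioo (s i) (t i)) : ∃ j, y ∈ Ioo (s j) (t j) := by
  rw [← h.mem_interior y hd.2.1, ← hd.2.2.2]
  exact (h.mem_interior x hd.1).2 ⟨i, hx⟩

/-- The order of the parameters at a crossing of two arcs depends on the arcs only. -/
theorem lt_iff (h : MeetsDiskIn K D s t) {i j : Fin m} (hij : i ≠ j) {x y : ℝ}
    (hx : x ∈ Icc (s i) (t i)) (hy : y ∈ Icc (s j) (t j)) : x < y ↔ s i < s j := by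
  constructor <;> intro hlt <;> by_contra hle <;> rw [not_lt] at hle
  · exact hij (h.eq_of_mem ⟨le_rfl, (h.bounds i).2.1.le⟩ ⟨hle, hx.1.trans (hlt.le.trans hy.2)⟩)
  · exact hij (h.eq_of_mem (x := s j) ⟨hlt.le, hy.1.trans (hle.trans hx.2)⟩
      ⟨le_rfl, (h.bounds j).2.1.le⟩)

end MeetsDiskIn

namespace DifferInDisk

variable {K K' : KnotoidDiagram} {D : SphereDisk} {m : ℕ} {s t : Fin m → ℝ}

theorem tail_eq (off : DifferInDisk K K' D s t) : K'.tail = K.tail :=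
  off.eq_off 0 (by simp) fun i hi => lt_irrefl _ ((off.left.bounds i).1.trans hi.1)

theorem head_eq (off : DifferInDisk K K' D s t) : K'.head = K.head :=
  off.eq_off 1 (by simp) fun i hi => lt_irrefl _ (hi.2.trans (off.left.bounds i).2.2)

theorem eq_start (off : DifferInDisk K K' D s t) (i : Fin m) : K'.toFun (s i) = K.toFun (s i) :=
  off.eq_off _ (Ioo_subset_Icc_self (off.left.Icc_subset i ⟨le_rfl, (off.left.bounds i).2.1.le⟩))
    fun j hj => by
      have := off.left.eq_of_mem ⟨le_rfl, (off.left.bounds i).2.1.le⟩ (Ioo_subset_Icc_self hj)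
      exact lt_irrefl _ (this ▸ hj).1

theorem eq_end (off : DifferInDisk K K' D s t) (i : Fin m) : K'.toFun (t i) = K.toFun (t i) :=
  off.eq_off _ (Ioo_subset_Icc_self (off.left.Icc_subset i ⟨(off.left.bounds i).2.1.le, le_rfl⟩))
    fun j hj => by
      have := off.left.eq_of_mem ⟨(off.left.bounds i).2.1.le, le_rfl⟩ (Ioo_subset_Icc_self hj)
      exact lt_irrefl _ (this ▸ hj).2

/-- The angular coordinates of two diagrams that differ in a disk: they agree outside the disk, and
on each arc they are, up to a constant, given by the same function on the disk. -/
theorem exists_isLog (off : DifferInDisk K K' D s t) {u w : E3}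
    (hdet : 0 < det3 u w (K.tail - K.head)) :
    ∃ (ℓ ℓ' : ℝ → ℂ) (lam : E3 → ℂ) (c : Fin m → ℂ), IsLog ℓ (K.axisCurve u w) (Ioo 0 1) ∧
      IsLog ℓ' (K'.axisCurve u w) (Ioo 0 1) ∧ (∀ x, (∀ i, x ∉ Ioo (s i) (t i)) → ℓ' x = ℓ x) ∧
      ∀ i, ∀ x ∈ Icc (s i) (t i),
        ℓ x = lam (K.toFun x) + c i ∧ ℓ' x = lam (K'.toFun x) + c i := by
  obtain ⟨ℓ, hl⟩ := K.exists_isLog_axisCurve hdet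
  set A : E3 → ℂ := fun P => axisProj u w (K.tail - K.head) (P - K.tail) with hA
  have hAc : Continuous A := (axisProj u w (K.tail - K.head)).continuous_of_finiteDimensional.comp
    (continuous_id.sub continuous_const)
  -- The disk contains neither endpoint, so the projection along the axis has a logarithm on all of
  -- it.
  obtain ⟨ℓD, hlD⟩ := Knotoids.exists_isLog (convex_closedBall (0 : ℂ) 1)
    (g := fun z => A (D.toFun z)) (hAc.comp_continuousOn D.continuousOn) fun z hz =>
      axisProj_ne_zero hdet K.tail_mem K.head_mem (D.mapsTo hz)
        (fun h => off.left.tail_notMem (h ▸ mem_image_of_mem _ hz))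
        (fun h => off.left.head_notMem (h ▸ mem_image_of_mem _ hz))
  set lam : E3 → ℂ := fun P => ℓD (D.inv P) with hlam
  have hllam : IsLog lam A D.carrier :=
    (hlD.comp D.continuousOn_inv fun P hP => D.inv_mem hP).congr fun P hP => by
      simp only [D.apply_inv hP]
  have hK : ∀ i, IsLog (fun x => lam (K.toFun x)) (K.axisCurve u w) (Icc (s i) (t i)) := fun i =>
    hllam.comp K.continuous.continuousOn fun x hx => off.left.mem_of_mem_Icc hx
  have hc : ∀ i, ∀ x ∈ Icc (s i) (t i),
      ℓ x = lam (K.toFun x) + (ℓ (s i) - lam (K.toFun (s i))) := fun i x hx => by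
    have := (hl.mono (off.left.Icc_subset i)).sub_eq_sub (hK i) isPreconnected_Icc
      ⟨le_rfl, (off.left.bounds i).2.1.le⟩ hx
    linear_combination this
  set clamp : Fin m → ℝ → ℝ := fun i x => max (s i) (min x (t i)) with hclamp
  have hclamp_mem : ∀ i x, clamp i x ∈ Icc (s i) (t i) := fun i x =>
    ⟨le_max_left _ _, max_le (off.left.bounds i).2.1.le (min_le_right _ _)⟩
  have hclamp_c : ∀ i, Continuous (clamp i) := fun i => by fun_prop
  have hclamp_eq : ∀ i, ∀ x ∈ Icc (s i) (t i), clamp i x = x := fun i x hx => by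
    simp only [hclamp, min_eq_left hx.2, max_eq_right hx.1]
  -- The change of the angle on the arc `i`. It vanishes at both ends, where the diagrams agree, so
  -- clamping the parameter extends it continuously by zero.
  set κ : Fin m → ℝ → ℂ := fun i x =>
    lam (K'.toFun (clamp i x)) - lam (K.toFun (clamp i x)) with hκ
  have hκc : ∀ i, Continuous (κ i) := fun i =>
    (hllam.continuousOn.comp_continuous (K'.continuous.comp (hclamp_c i))
      fun x => off.right.mem_of_mem_Icc (hclamp_mem i x)).sub
    (hllam.continuousOn.comp_continuous (K.continuous.comp (hclamp_c i))
      fun x => off.left.mem_of_mem_Icc (hclamp_mem i x))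
  have hκ0 : ∀ i x, x ∉ Ioo (s i) (t i) → κ i x = 0 := fun i x hx => by
    have hst := (off.left.bounds i).2.1.le
    have : clamp i x = s i ∨ clamp i x = t i := by
      rcases le_or_gt x (s i) with h | h
      · left
        simp only [hclamp, min_eq_left (h.trans hst), max_eq_left h]
      · right
        have : t i ≤ x := not_lt.1 fun h' => hx ⟨h, h'⟩
        simp only [hclamp, min_eq_right this, max_eq_right hst]
    rcases this with h | h <;> simp only [hκ, h]
    · rw [off.eq_start, sub_self]
    · rw [off.eq_end, sub_self]
  have hsum_off : ∀ x, (∀ i, x ∉ Ioo (s i) (t i)) → ∑ i, κ i x = 0 := fun x hx =>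
    Finset.sum_eq_zero fun i _ => hκ0 i x (hx i)
  have hsum_on : ∀ i, ∀ x ∈ Icc (s i) (t i),
      ∑ j, κ j x = lam (K'.toFun x) - lam (K.toFun x) := fun i x hx => by
    rw [Finset.sum_eq_single i (fun j _ hj => hκ0 j x fun h => hj
      (off.left.eq_of_mem (Ioo_subset_Icc_self h) hx)) (by simp)]
    simp only [hκ, hclamp_eq i x hx]
  refine ⟨ℓ, fun x => ℓ x + ∑ i, κ i x, lam, fun i => ℓ (s i) - lam (K.toFun (s i)), hl,
    ⟨hl.continuousOn.add (continuous_finsetSum _ fun i _ => hκc i).continuousOn, fun x hx => ?_⟩,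
    fun x hx => by simp only [hsum_off x hx, add_zero], fun i x hx => ⟨hc i x hx, ?_⟩⟩
  · rw [KnotoidDiagram.axisCurve, off.tail_eq, off.head_eq]
    by_cases h : ∀ i, x ∉ Ioo (s i) (t i)
    · rw [hsum_off x h, add_zero, hl.exp_eq x hx, off.eq_off x (Ioo_subset_Icc_self hx) h]
      rfl
    · push Not at h
      obtain ⟨i, hi⟩ := h
      have hi' := Ioo_subset_Icc_self hi
      rw [hsum_on i x hi', Complex.exp_add, Complex.exp_sub, hl.exp_eq x hx,
        hllam.exp_eq _ (off.right.mem_of_mem_Icc hi'), ← (hK i).exp_eq x hi',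
        mul_div_cancel₀ _ (Complex.exp_ne_zero _)]
  · simp only [hsum_on i x hx, hc i x hx]
    ring

/-- The variation of the angle of an arc in a disk, seen from a boundary point, depends only on the
ends of the arc. -/
theorem logVar_eq (off : DifferInDisk K K' D s t) {e₁ e₂ N : E3} (hf : IsFrame e₁ e₂ N)
    (hN : N ∈ S2) (hND : N ∉ D.carrier) (i : Fin m) {b : E3} (hb : b ∈ D.carrier)
    (hb' : b ∉ D.interior) (hKb : ∀ x ∈ Icc (s i) (t i), K.toFun x ≠ b)
    (hKb' : ∀ x ∈ Icc (s i) (t i), K'.toFun x ≠ b) {k : ℂ} (hk : k ≠ 0) :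
    logVar (fun x => k * (stereo e₁ e₂ N (K.toFun x) - stereo e₁ e₂ N b)) (s i) (t i) =
      logVar (fun x => k * (stereo e₁ e₂ N (K'.toFun x) - stereo e₁ e₂ N b)) (s i) (t i) := by
  have hne : ∀ P ∈ D.carrier, P ≠ N := fun P hP h => hND (h ▸ hP)
  -- A logarithm on the whole disk without `b` makes the variation along an arc a difference of
  -- values at its ends.
  obtain ⟨ℓ, hl⟩ := Knotoids.exists_isLog (D.convex_sdiff_boundary hb hb')
    (g := fun z => k * (stereo e₁ e₂ N (D.toFun z) - stereo e₁ e₂ N b))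
    (continuousOn_const.mul (((continuousOn_stereo hN).comp (D.continuousOn.mono sdiff_subset)
      fun z hz => ⟨D.mapsTo hz.1, hne _ (mem_image_of_mem _ hz.1)⟩).sub continuousOn_const))
    (fun z hz => mul_ne_zero hk (sub_ne_zero.2 fun h => hz.2 (by
      rw [mem_singleton_iff, ← hf.stereo_injOn hN (D.mapsTo hz.1) (D.carrier_subset hb)
        (hne _ (mem_image_of_mem _ hz.1)) (hne _ hb) h, D.inv_apply hz.1])))
  have hlog : ∀ L : KnotoidDiagram, MeetsDiskIn L D s t →
      (∀ x ∈ Icc (s i) (t i), L.toFun x ≠ b) →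
      logVar (fun x => k * (stereo e₁ e₂ N (L.toFun x) - stereo e₁ e₂ N b)) (s i) (t i) =
        ℓ (D.inv (L.toFun (t i))) - ℓ (D.inv (L.toFun (s i))) := fun L hL hLb => by
    refine IsLog.logVar_eq (ℓ := fun x => ℓ (D.inv (L.toFun x))) ?_ (hL.bounds i).2.1.le
    refine (hl.comp (φ := fun x => D.inv (L.toFun x)) (D.continuousOn_inv.comp
      L.continuous.continuousOn fun x hx => hL.mem_of_mem_Icc hx) fun x hx =>
        ⟨D.inv_mem (hL.mem_of_mem_Icc hx), fun h => hLb x hx ?_⟩).congr fun x hx => ?_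
    · have h' : D.inv (L.toFun x) = D.inv b := h
      rw [← D.apply_inv (hL.mem_of_mem_Icc hx), h', D.apply_inv hb]
    · rw [D.apply_inv (hL.mem_of_mem_Icc hx)]
  rw [hlog K off.left hKb, hlog K' off.right hKb', off.eq_start, off.eq_end]

end DifferInDisk

/-! ### Crossings of two arcs in a disk. -/

theorem finite_mutualCrossings (K : KnotoidDiagram) {m : ℕ} (s t : Fin m → ℝ) (i j : Fin m) :
    (mutualCrossings K s t i j).Finite :=
  K.finite_double.subset fun _ hc => hc.1

/-- On the rectangle of parameters of the two arcs, the zeros are their crossings. None lies on its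
boundary, since no crossing is on the boundary circle of `D`. -/
theorem MeetsDiskIn.boundaryVar_eq {K : KnotoidDiagram} {D : SphereDisk} {m : ℕ} {s t : Fin m → ℝ}
    (h : MeetsDiskIn K D s t) {e₁ e₂ N : E3} (hf : IsFrame e₁ e₂ N)
    (hN : N ∈ S2) (hND : N ∉ D.carrier) {i j : Fin m} (hij : i ≠ j) :
    boundaryVar (fun z => stereo e₁ e₂ N (K.toFun z.1) - stereo e₁ e₂ N (K.toFun z.2))
      (s i) (t i) (s j) (t j) =
      2 * Real.pi * Complex.I *
        ((-∑ᶠ c ∈ mutualCrossings K s t i j, K.pairSign c : ℤ) : ℂ) := by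
  have hfin := finite_mutualCrossings K s t i j
  have hS : ∀ i, ∀ x ∈ Icc (s i) (t i), K.toFun x ∈ S2 \ {N} := fun i x hx =>
    ⟨D.carrier_subset (h.mem_of_mem_Icc hx), fun he => hND (he ▸ h.mem_of_mem_Icc hx)⟩
  have hmem : ∀ z, z ∈ hfin.toFinset ↔ z ∈ mutualCrossings K s t i j := fun z => by simp
  have hdiff := K.smooth.differentiable (by simp)
  rw [boundaryVar_stereo_sub hf hN (h.bounds i).2.1 (h.bounds j).2.1 hdiff hdiff (hS i) (hS j)
    hfin.toFinset (fun z hz => ((hmem z).1 hz).2) (fun z hz => ?_)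
    (fun z hz => K.transverse _ _ ((hmem z).1 hz).1), finsum_mem_eq_finite_toFinset_sum _ hfin]
  · rfl
  · rw [hmem]
    refine ⟨fun heq => ?_, fun hz => hz.1.2.2.2⟩
    have hd : IsDouble K.toFun z.1 z.2 :=
      ⟨Ioo_subset_Icc_self (h.Icc_subset i hz.1), Ioo_subset_Icc_self (h.Icc_subset j hz.2),
        fun he => hij (h.eq_of_mem hz.1 (he ▸ hz.2)), heq⟩
    exact ⟨hd, h.mem_Ioo_of_isDouble hd hz.1, h.mem_Ioo_of_isDouble hd.symm hz.2⟩

namespace DifferInDisk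

variable {K K' : KnotoidDiagram} {D : SphereDisk} {m : ℕ} {s t : Fin m → ℝ}

/-- The signed number of crossings of two arcs in a disk depends only on the ends of the arcs. -/
theorem sum_pairSign_eq (off : DifferInDisk K K' D s t) {i j : Fin m} (hij : i ≠ j) :
    ∑ᶠ c ∈ mutualCrossings K s t i j, K.pairSign c =
      ∑ᶠ c ∈ mutualCrossings K' s t i j, K'.pairSign c := by
  obtain ⟨e₁, e₂, hf⟩ := exists_isFrame K.tail_mem
  have hND := off.left.tail_notMem
  have h1 := off.left.boundaryVar_eq hf K.tail_mem hND hij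
  have h2 := off.right.boundaryVar_eq hf K.tail_mem hND hij
  have hs : ∀ i, s i ∈ Icc (s i) (t i) := fun i => ⟨le_rfl, (off.left.bounds i).2.1.le⟩
  have ht : ∀ i, t i ∈ Icc (s i) (t i) := fun i => ⟨(off.left.bounds i).2.1.le, le_rfl⟩
  have hs' : ∀ i, s i ∉ Ioo (s i) (t i) := fun i h => lt_irrefl _ h.1
  have ht' : ∀ i, t i ∉ Ioo (s i) (t i) := fun i h => lt_irrefl _ h.2
  have hne : ∀ L : KnotoidDiagram, MeetsDiskIn L D s t → ∀ {i j : Fin m}, i ≠ j →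
      ∀ {y : ℝ}, y ∈ Icc (s j) (t j) → y ∉ Ioo (s j) (t j) →
      ∀ x ∈ Icc (s i) (t i), L.toFun x ≠ L.toFun y := fun L hL i j hij y hy hy' x hx heq =>
    hy' (hL.mem_Ioo_of_isDouble (y := x) ⟨Ioo_subset_Icc_self (hL.Icc_subset j hy),
      Ioo_subset_Icc_self (hL.Icc_subset i hx), fun he => hij (hL.eq_of_mem hx (he ▸ hy)),
      heq.symm⟩ hy)
  have hedge : ∀ {i j : Fin m}, i ≠ j → ∀ {y : ℝ}, y ∈ Icc (s j) (t j) →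
      y ∉ Ioo (s j) (t j) → K'.toFun y = K.toFun y → ∀ {k : ℂ}, k ≠ 0 →
      logVar (fun x => k * (stereo e₁ e₂ K.tail (K.toFun x) - stereo e₁ e₂ K.tail (K.toFun y)))
        (s i) (t i) =
      logVar (fun x => k * (stereo e₁ e₂ K.tail (K'.toFun x) - stereo e₁ e₂ K.tail (K'.toFun y)))
        (s i) (t i) := fun {i j} hij {y} hy hy' he {k} hk => by
    rw [he]
    exact off.logVar_eq hf K.tail_mem hND i (off.left.mem_of_mem_Icc hy)
      (off.left.notMem_interior hy hy') (hne K off.left hij hy hy')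
      (he ▸ hne K' off.right hij hy hy') hk
  have h3 : boundaryVar (fun z => stereo e₁ e₂ K.tail (K.toFun z.1)
        - stereo e₁ e₂ K.tail (K.toFun z.2)) (s i) (t i) (s j) (t j) =
      boundaryVar (fun z => stereo e₁ e₂ K.tail (K'.toFun z.1)
        - stereo e₁ e₂ K.tail (K'.toFun z.2)) (s i) (t i) (s j) (t j) := by
    have hedge₁ : ∀ {i j : Fin m}, i ≠ j → ∀ {y : ℝ}, y ∈ Icc (s j) (t j) →
        y ∉ Ioo (s j) (t j) → K'.toFun y = K.toFun y →
        logVar (fun x => stereo e₁ e₂ K.tail (K.toFun x) - stereo e₁ e₂ K.tail (K.toFun y))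
          (s i) (t i) =
        logVar (fun x => stereo e₁ e₂ K.tail (K'.toFun x) - stereo e₁ e₂ K.tail (K'.toFun y))
          (s i) (t i) := fun {_ _} hij {y} hy hy' he => by
      simpa only [one_mul] using hedge hij hy hy' he one_ne_zero
    -- On the vertical sides the fixed point comes first; the factor `k = -1` reverses the
    -- difference.
    have hedge₂ : ∀ {i j : Fin m}, i ≠ j → ∀ {y : ℝ}, y ∈ Icc (s j) (t j) →
        y ∉ Ioo (s j) (t j) → K'.toFun y = K.toFun y →
        logVar (fun x => stereo e₁ e₂ K.tail (K.toFun y) - stereo e₁ e₂ K.tail (K.toFun x))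
          (s i) (t i) =
        logVar (fun x => stereo e₁ e₂ K.tail (K'.toFun y) - stereo e₁ e₂ K.tail (K'.toFun x))
          (s i) (t i) := fun {_ _} hij {y} hy hy' he => by
      simpa only [neg_mul, one_mul, neg_sub] using
        hedge hij hy hy' he (neg_ne_zero.2 (one_ne_zero (α := ℂ)))
    unfold boundaryVar
    simp only
    rw [hedge₁ hij (hs j) (hs' j) (off.eq_start j), hedge₁ hij (ht j) (ht' j) (off.eq_end j),
      hedge₂ hij.symm (ht i) (ht' i) (off.eq_end i),
      hedge₂ hij.symm (hs i) (hs' i) (off.eq_start i)]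
  rw [h1, h2] at h3
  have h2pi : (2 * Real.pi * Complex.I : ℂ) ≠ 0 := by simp
  have := mul_left_cancel₀ h2pi h3
  exact neg_injective (by exact_mod_cast this)

end DifferInDisk

namespace DifferInDisk

variable {K K' : KnotoidDiagram} {D : SphereDisk} {m : ℕ} {s t : Fin m → ℝ}

/-- A crossing is never at an end of an arc, so the diagrams agree in a neighbourhood of both
parameters. -/
theorem pairSign_eq (off : DifferInDisk K K' D s t) {c : ℝ × ℝ} (hd : IsDouble K.toFun c.1 c.2)
    (hx : ∀ i, c.1 ∉ Ioo (s i) (t i)) (hy : ∀ i, c.2 ∉ Ioo (s i) (t i)) :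
    K.pairSign c = K'.pairSign c := by
  have hderiv : ∀ x ∈ Ioo (0 : ℝ) 1, (∀ i, x ∉ Icc (s i) (t i)) →
      deriv K'.toFun x = deriv K.toFun x := fun x hx hxi => by
    have hopen : IsOpen (⋃ i, Icc (s i) (t i))ᶜ :=
      (isClosed_iUnion_of_finite fun i => isClosed_Icc).isOpen_compl
    refine deriv_eq_of_eqOn (Filter.inter_mem (isOpen_Ioo.mem_nhds hx)
      (hopen.mem_nhds (by simpa only [mem_compl_iff, mem_iUnion, not_exists] using hxi)))
      fun z hz => off.eq_off z (Ioo_subset_Icc_self hz.1) fun i hi =>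
        hz.2 (mem_iUnion.2 ⟨i, Ioo_subset_Icc_self hi⟩)
  rw [KnotoidDiagram.pairSign, KnotoidDiagram.pairSign, off.eq_off _ hd.1 hx,
    hderiv _ (K.double_interior _ _ hd) fun i hi => hx i (off.left.mem_Ioo_of_isDouble hd hi),
    hderiv _ (K.double_interior _ _ hd.symm) fun i hi =>
      hy i (off.left.mem_Ioo_of_isDouble hd.symm hi)]

/-- The writhes of nonzero index do not change when a diagram is changed in a disk in which its arcs
lie in layers. The crossings of an arc with itself do not matter. -/
theorem writhe_eq (off : DifferInDisk K K' D s t)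
    (layers : ∀ i j, i < j → ∀ c ∈ mutualCrossings K s t i j, K.isOver c.1 c.2)
    (layers' : ∀ i j, i < j → ∀ c ∈ mutualCrossings K' s t i j, K'.isOver c.1 c.2)
    {n : ℤ} (hn : n ≠ 0) : K.writhe n = K'.writhe n := by
  classical
  obtain ⟨u, w, hdet⟩ := exists_det3_pos (sub_ne_zero.2 K.tail_ne_head)
  have hdet' : 0 < det3 u w (K'.tail - K'.head) := by rwa [off.tail_eq, off.head_eq]
  obtain ⟨ℓ, ℓ', lam, k, hl, hl', hoff, harc⟩ := off.exists_isLog hdet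
  -- At a crossing of the arcs `i` and `j` both strands have the same value of `lam`, so the index
  -- is determined by the constants and the order of the arcs. `Q i j` says that it is `n`, for
  -- either diagram.
  set Q : Fin m → Fin m → Prop := fun i j =>
    (if s i < s j then k j - k i else k i - k j) = 2 * Real.pi * Complex.I * n with hQ
  have hn' : (2 * Real.pi * Complex.I * n : ℂ) ≠ 0 := by simpa using hn
  have index_iff : ∀ (L : KnotoidDiagram) (ℓ : ℝ → ℂ), 0 < det3 u w (L.tail - L.head) →
      IsLog ℓ (L.axisCurve u w) (Ioo 0 1) → ∀ x y, IsDouble L.toFun x y →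
      (L.HasIndex (min x y, max x y) n ↔
        (if x < y then ℓ y - ℓ x else ℓ x - ℓ y) = 2 * Real.pi * Complex.I * n) :=
    fun L ℓ hL hlL x y hd => by
      rcases lt_or_gt_of_ne hd.2.2.1 with h | h
      · rw [min_eq_left h.le, max_eq_right h.le, if_pos h]
        exact KnotoidDiagram.hasIndex_iff hL hlL hd h
      · rw [min_eq_right h.le, max_eq_left h.le, if_neg h.not_gt]
        exact KnotoidDiagram.hasIndex_iff hL hlL hd.symm h
  have index_self : ∀ (L : KnotoidDiagram) (ℓ : ℝ → ℂ), 0 < det3 u w (L.tail - L.head) →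
      IsLog ℓ (L.axisCurve u w) (Ioo 0 1) →
      (∀ i, ∀ x ∈ Icc (s i) (t i), ℓ x = lam (L.toFun x) + k i) → ∀ i x y,
      IsDouble L.toFun x y → x ∈ Icc (s i) (t i) → y ∈ Icc (s i) (t i) →
      ¬ L.HasIndex (min x y, max x y) n := fun L ℓ hL hlL hk i x y hd hx hy h => by
    rw [index_iff L ℓ hL hlL x y hd, hk i x hx, hk i y hy, hd.2.2.2, sub_self, ite_self] at h
    exact hn' h.symm
  have index_arcs : ∀ (L : KnotoidDiagram) (ℓ : ℝ → ℂ), 0 < det3 u w (L.tail - L.head) →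
      IsLog ℓ (L.axisCurve u w) (Ioo 0 1) → MeetsDiskIn L D s t →
      (∀ i, ∀ x ∈ Icc (s i) (t i), ℓ x = lam (L.toFun x) + k i) → ∀ i j, i ≠ j → ∀ x y,
      IsDouble L.toFun x y → x ∈ Icc (s i) (t i) → y ∈ Icc (s j) (t j) →
      (L.HasIndex (min x y, max x y) n ↔ Q i j) :=
    fun L ℓ hL hlL hLD hk i j hij x y hd hx hy => by
      rw [index_iff L ℓ hL hlL x y hd, hk i x hx, hk j y hy, hd.2.2.2, add_sub_add_left_eq_sub,
        add_sub_add_left_eq_sub]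
      simp only [hQ, hLD.lt_iff hij hx hy]
  -- A crossing has either both parameters inside the arcs or none. `Off` collects the latter; `In`
  -- the former, sorted by pairs of arcs.
  set Off : KnotoidDiagram → Set (ℝ × ℝ) := fun L =>
    {c | c ∈ L.overPairs n ∧ (∀ i, c.1 ∉ Ioo (s i) (t i)) ∧ ∀ i, c.2 ∉ Ioo (s i) (t i)} with hOff
  set In : KnotoidDiagram → Fin m × Fin m → Set (ℝ × ℝ) := fun L p =>
    if p.1 < p.2 ∧ Q p.1 p.2 then mutualCrossings L s t p.1 p.2 else ∅ with hIn
  have mem_In : ∀ L p c, c ∈ In L p ↔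
      p.1 < p.2 ∧ Q p.1 p.2 ∧ c ∈ mutualCrossings L s t p.1 p.2 := fun L p c => by
    simp only [hIn]
    split_ifs with h
    · simp [h]
    · simp only [mem_empty_iff_false, false_iff]
      exact fun h' => h ⟨h'.1, h'.2.1⟩
  have hfinIn : ∀ L p, (In L p).Finite := fun L p =>
    (finite_mutualCrossings L s t p.1 p.2).subset fun c hc => ((mem_In L p c).1 hc).2.2
  have decomp : ∀ (L : KnotoidDiagram) (ℓ : ℝ → ℂ), 0 < det3 u w (L.tail - L.head) →
      IsLog ℓ (L.axisCurve u w) (Ioo 0 1) → MeetsDiskIn L D s t →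
      (∀ i, ∀ x ∈ Icc (s i) (t i), ℓ x = lam (L.toFun x) + k i) →
      (∀ i j, i < j → ∀ c ∈ mutualCrossings L s t i j, L.isOver c.1 c.2) →
      ∑ᶠ c ∈ L.overPairs n, (L.pairSign c : ℚ) =
        ∑ᶠ c ∈ Off L, (L.pairSign c : ℚ) + ∑ᶠ p, ∑ᶠ c ∈ In L p, (L.pairSign c : ℚ) := by
    intro L ℓ hL hlL hLD hk hlay
    have hunion : L.overPairs n = Off L ∪ ⋃ p, In L p := by
      ext ⟨x, y⟩
      simp only [mem_union, mem_iUnion, mem_In, hOff, mem_ofPred_eq]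
      constructor
      · intro hc
        by_cases hx : ∀ i, x ∉ Ioo (s i) (t i)
        · refine Or.inl ⟨hc, hx, fun j hy => ?_⟩
          obtain ⟨i, hi⟩ := hLD.exists_mem_Ioo_of_isDouble hc.1.symm hy
          exact hx i hi
        · push Not at hx
          obtain ⟨i, hi⟩ := hx
          obtain ⟨j, hj⟩ := hLD.exists_mem_Ioo_of_isDouble hc.1 hi
          have hi' := Ioo_subset_Icc_self hi
          have hj' := Ioo_subset_Icc_self hj
          right
          rcases lt_trichotomy i j with h | rfl | h
          -- Of the three cases, `i = j` would have index zero, and `j < i` contradicts the layers: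
          -- the over-strand belongs to the arc of smaller number.
          · exact ⟨(i, j), h, (index_arcs L ℓ hL hlL hLD hk i j h.ne x y hc.1 hi' hj').1 hc.2.2,
              hc.1, hi, hj⟩
          · exact absurd hc.2.2 (index_self L ℓ hL hlL hk i x y hc.1 hi' hj')
          · exact absurd hc.2.1 ((L.isOver_iff y x hc.1.symm).1
              (hlay j i h (y, x) ⟨hc.1.symm, hj, hi⟩))
      · rintro (hc | ⟨⟨i, j⟩, hij, hq, hc⟩)
        · exact hc.1
        · exact ⟨hc.1, hlay i j hij _ hc, (index_arcs L ℓ hL hlL hLD hk i j hij.ne x y hc.1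
            (Ioo_subset_Icc_self hc.2.1) (Ioo_subset_Icc_self hc.2.2)).2 hq⟩
    rw [hunion, finsum_mem_union, finsum_mem_iUnion _ (hfinIn L)]
    · rintro ⟨i, j⟩ ⟨i', j'⟩ hne
      rw [Function.onFun, disjoint_left]
      intro c hc hc'
      have h1 := ((mem_In _ _ _).1 hc).2.2
      have h2 := ((mem_In _ _ _).1 hc').2.2
      exact hne (Prod.ext
        (hLD.eq_of_mem (Ioo_subset_Icc_self h1.2.1) (Ioo_subset_Icc_self h2.2.1))
        (hLD.eq_of_mem (Ioo_subset_Icc_self h1.2.2) (Ioo_subset_Icc_self h2.2.2)))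
    · rw [disjoint_left]
      intro c hc hc'
      obtain ⟨p, hp⟩ := mem_iUnion.1 hc'
      exact hc.2.1 p.1 ((mem_In _ _ _).1 hp).2.2.2.1
    · exact (L.finite_overPairs n).subset fun c hc => hc.1
    · exact finite_iUnion (hfinIn L)
  have hOffeq : Off K = Off K' := by
    ext ⟨x, y⟩
    simp only [hOff, mem_ofPred_eq]
    refine and_congr_left fun ⟨hx, hy⟩ => ?_
    have hdd : IsDouble K.toFun x y ↔ IsDouble K'.toFun x y := by
      refine and_congr_right fun hx1 => and_congr_right fun hy1 => ?_
      rw [off.eq_off x hx1 hx, off.eq_off y hy1 hy]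
    simp only [KnotoidDiagram.overPairs, mem_ofPred_eq]
    rw [← hdd]
    refine and_congr_right fun hd => ?_
    rw [off.over_off x y hx hy hd, index_iff K ℓ hdet hl x y hd,
      index_iff K' ℓ' hdet' hl' x y (hdd.1 hd), hoff x hx, hoff y hy]
  rw [K.writhe_eq, K'.writhe_eq,
    decomp K ℓ hdet hl off.left (fun i x hx => (harc i x hx).1) layers,
    decomp K' ℓ' hdet' hl' off.right (fun i x hx => (harc i x hx).2) layers', ← hOffeq]
  congr 2
  · exact finsum_mem_congr rfl fun c hc => by rw [off.pairSign_eq hc.1.1 hc.2.1 hc.2.2]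
  · refine finsum_congr fun p => ?_
    simp only [hIn]
    split_ifs with h
    · have := congrArg (Int.cast : ℤ → ℚ) (off.sum_pairSign_eq h.1.ne)
      have hcast : ∀ L : KnotoidDiagram,
          ((∑ᶠ c ∈ mutualCrossings L s t p.1 p.2, L.pairSign c : ℤ) : ℚ) =
            ∑ᶠ c ∈ mutualCrossings L s t p.1 p.2, (L.pairSign c : ℚ) := fun L =>
        (Int.castAddHom ℚ).map_finsum_mem _ (finite_mutualCrossings L s t p.1 p.2)
      rwa [hcast, hcast] at this
    · simp

end DifferInDisk

/-! ### Invariance of the index polynomial -/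

theorem Move.writhe_eq {K K' : KnotoidDiagram} (h : Move K K') {n : ℤ} (hn : n ≠ 0) :
    K.writhe n = K'.writhe n := by
  cases h with
  | reparam ρ smooth deriv_pos zero one eq_comp over_comp =>
    exact writhe_eq_of_reparam smooth deriv_pos zero one eq_comp over_comp n
  | isotopy Φ eq_comp over_eq => exact writhe_eq_of_isotopy Φ eq_comp over_eq n
  | reidemeister_one D s t off before after =>
    -- With a single arc there is no pair `i < j`.
    exact off.writhe_eq (fun i j hij => by omega) (fun i j hij => by omega) hn
  | reidemeister_two D s t off embedded embedded' before after layers =>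
    have h01 : ∀ i j : Fin 2, i < j → i = 0 ∧ j = 1 := fun i j hij => by omega
    refine off.writhe_eq (fun i j hij c hc => ?_) (fun i j hij c hc => ?_) hn
    · obtain ⟨rfl, rfl⟩ := h01 i j hij
      rw [before] at hc
      exact absurd hc (notMem_empty c)
    · obtain ⟨rfl, rfl⟩ := h01 i j hij
      exact layers c hc
  | reidemeister_three D s t off embedded embedded' before after layers layers' =>
    exact off.writhe_eq layers layers' hn

theorem _root_.Relation.EqvGen.writhe_eq {K K' : KnotoidDiagram} (h : Relation.EqvGen Move K K')
    {n : ℤ} (hn : n ≠ 0) : K.writhe n = K'.writhe n := by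
  induction h with
  | rel _ _ hm => exact hm.writhe_eq hn
  | refl _ => rfl
  | symm _ _ _ ih => exact ih.symm
  | trans _ _ _ _ _ ih ih' => exact ih.trans ih'

theorem KnotoidDiagram.Represents.writhe_eq {k : Knotoid} {K K' : KnotoidDiagram}
    (h : K.Represents k) (h' : K'.Represents k) {n : ℤ} (hn : n ≠ 0) :
    K.writhe n = K'.writhe n := by
  have hrel : Relation.EqvGen Move K K' := Quotient.exact (h.trans h'.symm)
  exact hrel.writhe_eq hn

end Knotoids

end

/-- The index polynomial of a knotoid `k` may be computed from any diagram `K` of `k`. -/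
theorem theorem1p5 (k : Knotoids.Knotoid) (K : Knotoids.KnotoidDiagram) (hK : K.Represents k) :
    (Knotoids.degPos K.indexPolynomial : ℕ∞) ≤ k.posHeight ∧
      (Knotoids.degNeg K.indexPolynomial : ℕ∞) ≤ k.negHeight := by
  -- The infimum runs over all diagrams of `k`, so the polynomial is moved to the one that carries
  -- the shortcut.
  have key : ∀ K' : Knotoids.KnotoidDiagram, K'.Represents k →
      K.indexPolynomial = K'.indexPolynomial := fun K' hK' =>
    K.indexPolynomial_congr fun n hn => hK.writhe_eq hK' hn
  constructor
  · refine le_iInf fun K' => le_iInf fun hK' => le_iInf fun a => ?_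
    rw [key K' hK']
    exact_mod_cast a.degPos_le.1
  · refine le_iInf fun K' => le_iInf fun hK' => le_iInf fun a => ?_
    rw [key K' hK']
    exact_mod_cast a.degPos_le.2
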